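/- Let $T>2$, let $\mathcal X$ be a measurable space with a probability measure $\mu$, let $P_0=\mu^{\otimes T}$ be the law under which $\mathbf X_T=(X_1,\dots,X_T)$ is i.i.d. with marginal law $\mu$, and let $h:\mathcal X^T\to\mathbb R$ be measurable and bounded. Write $E_0,\mathrm{Var}_0$ for expectation and variance under $P_0$. For probability laws put $\chi^2(P_1,P_2)=E_2\big(\tfrac{dP_1}{dP_2}-1\big)^2$ (equal to $\infty$ if $P_1\not\ll P_2$), and for a bivariate law $P$ with marginals $P_X,P_Y$ put $\phi^2(P)=\chi^2(P,P_X\times P_Y)$. A process is called $p$-dependent if for every $t$, conditionally on $X_t,\dots,X_{t+p-1}$, the past $(X_s)_{s<t}$ and the future $(X_s)_{s\ge t+p}$ are independent. For a law $P_f$ of $\mathbf X_T$ let $P_{\tilde f_1}$ be its 1-dependent counterpart, i.e. the law of the 1-dependent process with $P_{\tilde f_1}(x_{t-1},x_t)=P_f(x_{t-1},x_t)$ for all $t=2,\dots,T$, and put $$\phi_2^2(P_f(x_{t-2},x_{t-1},x_t))=\chi^2\big(P_f(x_{t-2},x_{t-1},x_t),\,P_{\tilde f_1}(x_{t-2},x_{t-1},x_t)\big).$$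 For $\eta_1,\eta_2\ge0$ consider the maximization (supremum) and the minimization (infimum) of $E_f[h(\mathbf X_T)]$ over all laws $P_f\ll P_0$ on $\mathcal X^T$ under which $(X_t)_{t=1,\dots,T}$ is a stationary 2-dependent process with marginal law $\mu$ and such that $\phi^2(P_f(x_{t-1},x_t))\le\eta_1$ for $t=2,\dots,T$ and $\phi_2^2(P_f(x_{t-2},x_{t-1},x_t))\le\eta_2$ for $t=3,\dots,T$. The set of attainable values is non-empty and bounded, and, as $(\eta_1,\eta_2)\to(0,0)$, $$\max E_f[h(\mathbf X_T)]\le E_0[h(\mathbf X_T)]+\sqrt{\mathrm{Var}_0(R(X,Y))\,\eta_1}+\sqrt{\mathrm{Var}_0(S(X,Y,Z))\,\eta_2}+o(\sqrt{\eta_1}+\sqrt{\eta_2}),$$ $$\min E_f[h(\mathbf X_T)]\ge E_0[h(\mathbf X_T)]-\sqrt{\mathrm{Var}_0(R(X,Y))\,\eta_1}-\sqrt{\mathrm{Var}_0(S(X,Y,Z))\,\eta_2}+o(\sqrt{\eta_1}+\sqrt{\eta_2}),$$ where $X,Y,Z$ are i.i.d. with law $\mu$, $$R(x,y)=\sum_{t=2}^TE_0[h(\mathbf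 X_T)|X_{t-1}=x,X_t=y]-\sum_{t=2}^TE_0[h(\mathbf X_T)|X_{t-1}=x]-\sum_{t=2}^TE_0[h(\mathbf X_T)|X_t=y]+(T-1)E_0[h(\mathbf X_T)],$$ $$S(x,y,z)=\sum_{t=3}^TE_0[h(\mathbf X_T)|X_{t-2}=x,X_{t-1}=y,X_t=z]-\sum_{t=3}^TE_0[h(\mathbf X_T)|X_{t-2}=x,X_{t-1}=y]-\sum_{t=3}^TE_0[h(\mathbf X_T)|X_{t-1}=y,X_t=z]+\sum_{t=3}^TE_0[h(\mathbf X_T)|X_{t-1}=y].$$ -/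

import Mathlib

open MeasureTheory ProbabilityTheory Topology

namespace SerialDependency

/-- The `χ²`-distance `χ²(P₁, P₂) = E₂ (dP₁/dP₂ - 1)²`, equal to `∞` when `P₁` is not absolutely
continuous with respect to `P₂`. -/
noncomputable def chiSq {α : Type*} [MeasurableSpace α] (P₁ P₂ : Measure α) : ENNReal :=
  open scoped Classical in
  if P₁ ≪ P₂ then ∫⁻ a, ENNReal.ofReal (((P₁.rnDeriv P₂ a).toReal - 1) ^ 2) ∂P₂ else ⊤

/-- The `φ²`-coefficient of a bivariate law: its `χ²`-distance to the product of its marginals. -/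
noncomputable def phiSq {α : Type*} [MeasurableSpace α] (ν : Measure (α × α)) : ENNReal :=
  chiSq ν ((ν.map Prod.fst).prod (ν.map Prod.snd))

/-- Conditional independence, under `P`, of the σ-algebras `m₁` and `m₂` given `m'`. -/
def CondIndepSigma {Ω : Type*} (m' m₁ m₂ : MeasurableSpace Ω) [MeasurableSpace Ω]
    (P : Measure Ω) : Prop :=
  ∀ A B : Set Ω, MeasurableSet[m₁] A → MeasurableSet[m₂] B →
    P[(A ∩ B).indicator (fun _ => (1 : ℝ)) | m'] =ᵐ[P]
      P[A.indicator (fun _ => (1 : ℝ)) | m'] * P[B.indicator (fun _ => (1 : ℝ)) | m']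

section Sequence

variable {𝒳 : Type*} [MeasurableSpace 𝒳] {T : ℕ}

/-- The law of `(X_i, X_j)` when the whole sequence has law `P`. -/
noncomputable def pairLaw (P : Measure (Fin T → 𝒳)) (i j : Fin T) : Measure (𝒳 × 𝒳) :=
  P.map (fun x => (x i, x j))

/-- The law of `(X_i, X_j, X_k)` when the whole sequence has law `P`. -/
noncomputable def tripleLaw (P : Measure (Fin T → 𝒳)) (i j k : Fin T) : Measure (𝒳 × 𝒳 × 𝒳) :=
  P.map (fun x => (x i, x j, x k))

/-- `p`-dependence (the Markov property of order `p`): for every `t`, given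
`X_t, …, X_{t+p-1}`, the past `(X_s)_{s < t}` and the future `(X_s)_{s ≥ t + p}` are
independent. -/
def IsDependent (p : ℕ) (P : Measure (Fin T → 𝒳)) : Prop :=
  ∀ t : ℕ, CondIndepSigma
    (cylinderEvents (X := fun _ : Fin T => 𝒳) {s | t ≤ (s : ℕ) ∧ (s : ℕ) < t + p})
    (cylinderEvents (X := fun _ : Fin T => 𝒳) {s | (s : ℕ) < t})
    (cylinderEvents (X := fun _ : Fin T => 𝒳) {s | t + p ≤ (s : ℕ)}) P

/-- Strict stationarity of a finite sequence: any `m` consecutive entries have the same joint law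
as the first `m` entries. -/
def IsStationary (P : Measure (Fin T → 𝒳)) : Prop :=
  ∀ (m s : ℕ) (hs : s + m ≤ T),
    P.map (fun x (i : Fin m) => x ⟨s + i, by omega⟩) =
      P.map (fun x (i : Fin m) => x ⟨i, by omega⟩)

/-- The law of an i.i.d. sequence of length `T` with marginal law `μ`. -/
noncomputable def baseline (μ : Measure 𝒳) (T : ℕ) : Measure (Fin T → 𝒳) :=
  Measure.pi (fun _ => μ)

/-- `Q` is the law of the 1-dependent counterpart of the process with law `P`: a 1-dependent
process with the same laws of pairs of consecutive states. (These laws determine `Q`.) -/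
structure IsOneDependentCounterpart (Q P : Measure (Fin T → 𝒳)) : Prop where
  isProbabilityMeasure : IsProbabilityMeasure Q
  isDependent : IsDependent 1 Q
  pairLaw_eq : ∀ i j : Fin T, (j : ℕ) = i + 1 → pairLaw Q i j = pairLaw P i j

/-- The feasible laws of the worst-case optimization with lag-one threshold `η₁` and lag-two
threshold `η₂`. -/
structure IsFeasible (μ : Measure 𝒳) (η₁ η₂ : ℝ) (P : Measure (Fin T → 𝒳)) : Prop where
  isProbabilityMeasure : IsProbabilityMeasure P
  lagOne : ∀ i j : Fin T, (j : ℕ) = i + 1 → phiSq (pairLaw P i j) ≤ ENNReal.ofReal η₁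
  lagTwo : ∃ Q : Measure (Fin T → 𝒳), IsOneDependentCounterpart Q P ∧
    ∀ i j k : Fin T, (j : ℕ) = i + 1 → (k : ℕ) = j + 1 →
      chiSq (tripleLaw P i j k) (tripleLaw Q i j k) ≤ ENNReal.ofReal η₂
  isDependent : IsDependent 2 P
  isStationary : IsStationary P
  marginal : ∀ i : Fin T, P.map (fun x => x i) = μ
  absolutelyContinuous : P ≪ baseline μ T

/-- The set of attainable values `E_f[h(X_1, …, X_T)]`, `P_f` feasible. -/
def values (μ : Measure 𝒳) (h : (Fin T → 𝒳) → ℝ) (η₁ η₂ : ℝ) : Set ℝ :=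
  {v | ∃ P : Measure (Fin T → 𝒳), IsFeasible μ η₁ η₂ P ∧ v = ∫ x, h x ∂P}

/-- Optimal value of the max formulation. -/
noncomputable def maxValue (μ : Measure 𝒳) (h : (Fin T → 𝒳) → ℝ) (η₁ η₂ : ℝ) : ℝ :=
  sSup (values μ h η₁ η₂)

/-- Optimal value of the min formulation. -/
noncomputable def minValue (μ : Measure 𝒳) (h : (Fin T → 𝒳) → ℝ) (η₁ η₂ : ℝ) : ℝ :=
  sInf (values μ h η₁ η₂)

/-- `E₀[h]`, the expectation under the i.i.d. baseline. -/
noncomputable def E0 (μ : Measure 𝒳) (h : (Fin T → 𝒳) → ℝ) : ℝ :=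
  ∫ w, h w ∂(baseline μ T)

/-- `E₀[h | X_i = x]`: under the i.i.d. baseline, the coordinate `i` is fixed and the others are
averaged out. -/
noncomputable def condE1 (μ : Measure 𝒳) (h : (Fin T → 𝒳) → ℝ) (i : Fin T) (x : 𝒳) : ℝ :=
  E0 μ (fun w => h (Function.update w i x))

/-- `E₀[h | X_i = x, X_j = y]` for `i ≠ j`. -/
noncomputable def condE2 (μ : Measure 𝒳) (h : (Fin T → 𝒳) → ℝ) (i j : Fin T) (x y : 𝒳) : ℝ :=
  E0 μ (fun w => h (Function.update (Function.update w i x) j y))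

/-- `E₀[h | X_i = x, X_j = y, X_k = z]` for distinct `i, j, k`. -/
noncomputable def condE3 (μ : Measure 𝒳) (h : (Fin T → 𝒳) → ℝ) (i j k : Fin T) (x y z : 𝒳) : ℝ :=
  E0 μ (fun w => h (Function.update (Function.update (Function.update w i x) j y) k z))

/-- The two-variable interaction function `R`; the consecutive pair at `t : Fin (T - 1)` is
`(X_t, X_{t+1})` with indices counted from `0`. -/
noncomputable def R (μ : Measure 𝒳) (h : (Fin T → 𝒳) → ℝ) (x y : 𝒳) : ℝ :=
  (∑ t : Fin (T - 1), condE2 μ h ⟨t, by omega⟩ ⟨t + 1, by omega⟩ x y)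
    - (∑ t : Fin (T - 1), condE1 μ h ⟨t, by omega⟩ x)
    - (∑ t : Fin (T - 1), condE1 μ h ⟨t + 1, by omega⟩ y)
    + ((T : ℝ) - 1) * E0 μ h

/-- The three-variable interaction function `S`; the consecutive triple at `t : Fin (T - 2)` is
`(X_t, X_{t+1}, X_{t+2})` with indices counted from `0`. -/
noncomputable def S (μ : Measure 𝒳) (h : (Fin T → 𝒳) → ℝ) (x y z : 𝒳) : ℝ :=
  (∑ t : Fin (T - 2),
      condE3 μ h ⟨t, by omega⟩ ⟨t + 1, by omega⟩ ⟨t + 2, by omega⟩ x y z)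
    - (∑ t : Fin (T - 2), condE2 μ h ⟨t, by omega⟩ ⟨t + 1, by omega⟩ x y)
    - (∑ t : Fin (T - 2), condE2 μ h ⟨t + 1, by omega⟩ ⟨t + 2, by omega⟩ y z)
    + (∑ t : Fin (T - 2), condE1 μ h ⟨t + 1, by omega⟩ y)

/-- `Var₀(R(X, Y))` for `X, Y` i.i.d. with law `μ`. -/
noncomputable def varR (μ : Measure 𝒳) (h : (Fin T → 𝒳) → ℝ) : ℝ :=
  variance (fun p : 𝒳 × 𝒳 => R μ h p.1 p.2) (μ.prod μ)

/-- `Var₀(S(X, Y, Z))` for `X, Y, Z` i.i.d. with law `μ`. -/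
noncomputable def varS (μ : Measure 𝒳) (h : (Fin T → 𝒳) → ℝ) : ℝ :=
  variance (fun p : 𝒳 × 𝒳 × 𝒳 => S μ h p.1 p.2.1 p.2.2) (μ.prod (μ.prod μ))

end Sequence

end SerialDependency

/-!
Deform the i.i.d. law into `P` one entry at a time: the `n`-th law takes its first `n` entries
from a sequence with law `P` and the others independently from `μ`. Passing from one law to the
next, 2-dependence lets the new entry depend on its two predecessors only. It is made to do so in
two half steps, first with the lag-one density `L`, then with the density `V` of a triple relative
to its Markov counterpart. A half step changes the expectation of `h` by `∫ (L - 1) E₀[h | pair]`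
or `∫ (V - 1) E₀[h | triple]`, up to an error of higher order because all the laws involved are
close to the i.i.d. law. Since `L` keeps the one-entry marginals and `V` the pair marginals, the
conditional expectations may be replaced by their projections, whose sums are `R` and `S`. The
Cauchy–Schwarz inequality against the `χ²`-bounds on `L - 1` and `V - 1` produces the two square
roots.
-/

namespace SerialDependency

open scoped ENNReal NNReal Asymptotics

section MeanSquare

variable {Ω E : Type*} [MeasurableSpace Ω] [MeasurableSpace E]

lemma abs_integral_mul_le_sqrt {A : Measure Ω} {f g : Ω → ℝ} (hf : MemLp f 2 A)
    (hg : MemLp g 2 A) :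
    |∫ x, f x * g x ∂A| ≤ √(∫ x, f x ^ 2 ∂A) * √(∫ x, g x ^ 2 ∂A) := by
  have holder := integral_mul_le_Lp_mul_Lq_of_nonneg (μ := A) Real.HolderConjugate.two_two
    (f := fun x => |f x|) (g := fun x => |g x|) (ae_of_all _ fun _ => abs_nonneg _)
    (ae_of_all _ fun _ => abs_nonneg _) (by rw [ENNReal.ofReal_ofNat]; exact hf.abs)
    (by rw [ENNReal.ofReal_ofNat]; exact hg.abs)
  calc |∫ x, f x * g x ∂A| ≤ ∫ x, |f x * g x| ∂A := abs_integral_le_integral_abs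
    _ = ∫ x, |f x| * |g x| ∂A := by simp only [abs_mul]
    _ ≤ _ := holder
    _ = _ := by simp only [Real.rpow_two, sq_abs, Real.sqrt_eq_rpow]

lemma memLp_of_abs_le {A : Measure Ω} [IsFiniteMeasure A] {f : Ω → ℝ} (hf : Measurable f) {K : ℝ}
    (hK : ∀ x, |f x| ≤ K) {p : ℝ≥0∞} : MemLp f p A :=
  MemLp.of_bound hf.aestronglyMeasurable K (ae_of_all _ hK)

lemma sqrt_integral_sq_le {A : Measure Ω} [IsProbabilityMeasure A] {f : Ω → ℝ} {K : ℝ≥0}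
    (hK : ∀ x, |f x| ≤ K) : √(∫ x, f x ^ 2 ∂A) ≤ K := by
  refine Real.sqrt_le_iff.2 ⟨K.coe_nonneg, ?_⟩
  calc ∫ x, f x ^ 2 ∂A ≤ ∫ _, (K : ℝ) ^ 2 ∂A :=
        integral_mono_of_nonneg (ae_of_all _ fun _ => sq_nonneg _) (integrable_const _)
          (ae_of_all _ fun x => sq_le_sq' (abs_le.1 (hK x)).1 (abs_le.1 (hK x)).2)
    _ = (K : ℝ) ^ 2 := by simp

lemma map_withDensity_comp {A : Measure Ω} {π : Ω → E} (hπ : Measurable π) {f : E → ℝ≥0∞}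
    (hf : Measurable f) :
    (A.withDensity fun x => f (π x)).map π = (A.map π).withDensity f := by
  ext s hs
  rw [Measure.map_apply hπ hs, withDensity_apply _ (hπ hs), withDensity_apply _ hs,
    setLIntegral_map hs hf hπ]

/-- The expectations of bounded functions under `A` and `A₀` differ by at most `δ` times the bound:
closeness in total variation, tested on functions so that it can be used directly. -/
def TVClose (A A₀ : Measure Ω) (δ : ℝ) : Prop :=
  ∀ (f : Ω → ℝ) (K : ℝ≥0), Measurable f → (∀ x, |f x| ≤ K) →
    |∫ x, f x ∂A - ∫ x, f x ∂A₀| ≤ K * δ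

namespace TVClose

variable {A A₀ A₁ : Measure Ω} {δ δ' : ℝ}

lemma refl (A : Measure Ω) : TVClose A A 0 := fun f K _ _ => by simp

lemma trans (h₁ : TVClose A A₁ δ) (h₀ : TVClose A₁ A₀ δ') : TVClose A A₀ (δ + δ') :=
  fun f K hf hK => by
    rw [mul_add]
    exact (abs_sub_le _ _ _).trans (add_le_add (h₁ f K hf hK) (h₀ f K hf hK))

lemma mono (h : TVClose A A₀ δ) (hδ : δ ≤ δ') : TVClose A A₀ δ' := fun f K hf hK =>
  (h f K hf hK).trans (mul_le_mul_of_nonneg_left hδ K.coe_nonneg)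

lemma map (h : TVClose A A₀ δ) {π : Ω → E} (hπ : Measurable π) :
    TVClose (A.map π) (A₀.map π) δ := fun f K hf hK => by
  rw [integral_map hπ.aemeasurable hf.aestronglyMeasurable,
    integral_map hπ.aemeasurable hf.aestronglyMeasurable]
  exact h _ K (hf.comp hπ) fun x => hK (π x)

lemma nonneg (h : TVClose A A₀ δ) : 0 ≤ δ := by
  simpa using h (fun _ => 0) 1 measurable_const (by simp)

lemma sqrt_variance_le [IsProbabilityMeasure A] [IsProbabilityMeasure A₀] (h : TVClose A A₀ δ)
    {f : Ω → ℝ} {K : ℝ≥0} (hf : Measurable f) (hK : ∀ x, |f x| ≤ K) :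
    √(variance f A) ≤ √(variance f A₀) + 2 * K * √δ := by
  set m := ∫ x, f x ∂A₀
  have hfm : Measurable fun x => f x - m := hf.sub_const m
  have hmK : |m| ≤ K := by
    simpa using norm_integral_le_of_norm_le_const (μ := A₀) (f := f) (ae_of_all _ hK)
  have hsq (x : Ω) : |(f x - m) ^ 2| ≤ ((2 * K) ^ 2 : ℝ≥0) := by
    rw [abs_pow, NNReal.coe_pow, NNReal.coe_mul, NNReal.coe_two, two_mul]
    exact pow_le_pow_left₀ (abs_nonneg _) ((abs_sub _ _).trans (add_le_add (hK x) hmK)) 2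
  have hvar : variance f A ≤ variance f A₀ + (2 * K) ^ 2 * δ := by
    calc variance f A = variance (fun x => f x - m) A :=
          (variance_sub_const hf.aestronglyMeasurable m).symm
      _ ≤ ∫ x, (f x - m) ^ 2 ∂A := variance_le_expectation_sq hfm.aestronglyMeasurable
      _ ≤ ∫ x, (f x - m) ^ 2 ∂A₀ + (2 * K) ^ 2 * δ := by
          have := (abs_le.1 (h _ _ (hfm.pow_const 2) hsq)).2
          push_cast at this
          linarith
      _ = variance f A₀ + (2 * K) ^ 2 * δ := by rw [variance_eq_integral hf.aemeasurable]
  refine Real.sqrt_le_iff.2 ⟨by positivity, hvar.trans ?_⟩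
  have hcross : 0 ≤ √(variance f A₀) * (2 * K * √δ) := by positivity
  nlinarith [Real.sq_sqrt (variance_nonneg f A₀), Real.sq_sqrt h.nonneg]

end TVClose

/-- `v` is the density with respect to `ν` of a law at `χ²`-distance at most `η` from `ν`. -/
structure IsChiSqDensity (ν : Measure E) (v : E → ℝ≥0) (η : ℝ) : Prop where
  measurable : Measurable v
  memLp : MemLp (fun e => (v e : ℝ) - 1) 2 ν
  integral_sq_le : ∫ e, ((v e : ℝ) - 1) ^ 2 ∂ν ≤ η

namespace IsChiSqDensity

variable {ν : Measure E} {v : E → ℝ≥0} {η : ℝ}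

lemma comp {A : Measure Ω} {π : Ω → E} (hv : IsChiSqDensity (A.map π) v η) (hπ : Measurable π) :
    IsChiSqDensity A (fun x => v (π x)) η where
  measurable := hv.measurable.comp hπ
  memLp := hv.memLp.comp_of_map hπ.aemeasurable
  integral_sq_le := by
    have hsq : Measurable fun e => ((v e : ℝ) - 1) ^ 2 := by
      have := hv.measurable
      fun_prop
    simpa only [integral_map hπ.aemeasurable hsq.aestronglyMeasurable] using hv.integral_sq_le

lemma integrable_mul (hv : IsChiSqDensity ν v η) {c : E → ℝ} (hc : MemLp c 2 ν) :
    Integrable (fun e => ((v e : ℝ) - 1) * c e) ν :=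
  hv.memLp.integrable_mul hc

lemma abs_integral_mul_le (hv : IsChiSqDensity ν v η) {c : E → ℝ} (hc : MemLp c 2 ν) :
    |∫ e, ((v e : ℝ) - 1) * c e ∂ν| ≤ √η * √(∫ e, c e ^ 2 ∂ν) :=
  (abs_integral_mul_le_sqrt hv.memLp hc).trans
    (mul_le_mul_of_nonneg_right (Real.sqrt_le_sqrt hv.integral_sq_le) (Real.sqrt_nonneg _))

lemma integral_withDensity_sub [IsFiniteMeasure ν] (hv : IsChiSqDensity ν v η) {f : E → ℝ}
    (hf : MemLp f 2 ν) :
    ∫ e, f e ∂(ν.withDensity fun e => v e) - ∫ e, f e ∂ν = ∫ e, ((v e : ℝ) - 1) * f e ∂ν := by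
  rw [integral_withDensity_eq_integral_smul hv.measurable, sub_eq_iff_eq_add,
    ← integral_add (hv.integrable_mul hf) (hf.integrable one_le_two)]
  refine integral_congr_ae (ae_of_all _ fun e => ?_)
  simp only [NNReal.smul_def, smul_eq_mul]
  ring

lemma tvClose [IsProbabilityMeasure ν] (hv : IsChiSqDensity ν v η) :
    TVClose (ν.withDensity fun e => v e) ν √η := fun f K hf hK => by
  have hf₂ : MemLp f 2 ν := memLp_of_abs_le hf hK
  rw [hv.integral_withDensity_sub hf₂, mul_comm (K : ℝ)]
  exact (hv.abs_integral_mul_le hf₂).trans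
    (mul_le_mul_of_nonneg_left (sqrt_integral_sq_le hK) (Real.sqrt_nonneg _))

lemma abs_integral_mul_le_sqrt_variance [IsProbabilityMeasure ν]
    [IsProbabilityMeasure (ν.withDensity fun e => v e)] (hv : IsChiSqDensity ν v η) {c : E → ℝ}
    (hc : MemLp c 2 ν) : |∫ e, ((v e : ℝ) - 1) * c e ∂ν| ≤ √η * √(variance c ν) := by
  have centered : ∫ e, ((v e : ℝ) - 1) * c e ∂ν =
      ∫ e, ((v e : ℝ) - 1) * (c e - ∫ e, c e ∂ν) ∂ν := by
    have hone := hv.integral_withDensity_sub (f := fun _ => ∫ e, c e ∂ν) (memLp_const _)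
    simp only [mul_sub]
    rw [integral_sub (hv.integrable_mul hc) (hv.integrable_mul (memLp_const _)), ← hone]
    simp
  rw [centered, variance_eq_integral hc.aemeasurable]
  exact hv.abs_integral_mul_le (hc.sub (memLp_const _))

/-- A density that leaves the law of `g` unchanged is orthogonal to the functions of `g`. -/
lemma integral_mul_add_comp {F : Type*} [MeasurableSpace F] [IsFiniteMeasure ν]
    (hv : IsChiSqDensity ν v η) {c : E → ℝ} (hc : MemLp c 2 ν) {g : E → F} (hg : Measurable g)
    (hmap : (ν.withDensity fun e => v e).map g = ν.map g) {a : F → ℝ} (ha : Measurable a)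
    (ha₂ : MemLp (fun e => a (g e)) 2 ν) :
    ∫ e, ((v e : ℝ) - 1) * (c e + a (g e)) ∂ν = ∫ e, ((v e : ℝ) - 1) * c e ∂ν := by
  have orthogonal : ∫ e, ((v e : ℝ) - 1) * a (g e) ∂ν = 0 := by
    rw [← hv.integral_withDensity_sub ha₂, sub_eq_zero,
      ← integral_map hg.aemeasurable ha.aestronglyMeasurable, hmap,
      integral_map hg.aemeasurable ha.aestronglyMeasurable]
  simp only [mul_add]
  rw [integral_add (hv.integrable_mul hc) (hv.integrable_mul ha₂), orthogonal, add_zero]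

end IsChiSqDensity

lemma exists_density_of_chiSq_le {P₁ P₂ : Measure E} [IsProbabilityMeasure P₁]
    [IsProbabilityMeasure P₂] {η : ℝ} (hη : 0 ≤ η) (h : chiSq P₁ P₂ ≤ ENNReal.ofReal η) :
    ∃ v : E → ℝ≥0, IsChiSqDensity P₂ v η ∧ P₁ = P₂.withDensity fun e => v e := by
  have hac : P₁ ≪ P₂ := by
    by_contra hac
    rw [chiSq, if_neg hac, top_le_iff] at h
    exact ENNReal.ofReal_ne_top h
  rw [chiSq, if_pos hac] at h
  set v : E → ℝ≥0 := fun e => (P₁.rnDeriv P₂ e).toNNReal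
  have hv : Measurable v := (Measure.measurable_rnDeriv _ _).ennreal_toNNReal
  have hv' : Measurable fun e => (v e : ℝ) - 1 := by fun_prop
  have hlt : ∫⁻ e, ENNReal.ofReal (((v e : ℝ) - 1) ^ 2) ∂P₂ < ∞ :=
    h.trans_lt ENNReal.ofReal_lt_top
  refine ⟨v, ⟨hv, ?_, ?_⟩, ?_⟩
  · rw [memLp_two_iff_integrable_sq hv'.aestronglyMeasurable]
    exact (lintegral_ofReal_ne_top_iff_integrable (hv'.pow_const 2).aestronglyMeasurable
      (ae_of_all _ fun _ => sq_nonneg _)).1 hlt.ne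
  · rw [integral_eq_lintegral_of_nonneg_ae (ae_of_all _ fun _ => sq_nonneg _)
      (hv'.pow_const 2).aestronglyMeasurable]
    exact ENNReal.toReal_le_of_le_ofReal hη h
  · conv_lhs => rw [← Measure.withDensity_rnDeriv_eq P₁ P₂ hac]
    refine withDensity_congr_ae ?_
    filter_upwards [Measure.rnDeriv_lt_top P₁ P₂] with e he
    exact (ENNReal.coe_toNNReal he.ne).symm

end MeanSquare

section Projection

variable {Ω E : Type*} [MeasurableSpace E] {m mΩ : MeasurableSpace Ω} {A P₀ : Measure Ω}

lemma integral_mul_condExp (hm : m ≤ mΩ) [IsFiniteMeasure A] {u d : Ω → ℝ}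
    (hu : StronglyMeasurable[m] u) (hu₂ : MemLp u 2 A) (hd : MemLp d 2 A) :
    ∫ x, u x * A[d | m] x ∂A = ∫ x, u x * d x ∂A := by
  calc ∫ x, u x * A[d | m] x ∂A = ∫ x, A[u * d | m] x ∂A :=
        integral_congr_ae (condExp_mul_of_stronglyMeasurable_left hu (hu₂.integrable_mul hd)
          (hd.integrable one_le_two)).symm
    _ = ∫ x, u x * d x ∂A := integral_condExp hm

lemma exists_stronglyMeasurable_ae_eq_condExp {d : Ω → ℝ} {K : ℝ≥0} (hK : ∀ x, |d x| ≤ K) :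
    ∃ g : Ω → ℝ, StronglyMeasurable[m] g ∧ (∀ x, |g x| ≤ K) ∧ g =ᵐ[A] A[d | m] := by
  refine ⟨fun x => max (-K) (min K (A[d | m] x)), Measurable.stronglyMeasurable
      (measurable_const.max (measurable_const.min stronglyMeasurable_condExp.measurable)),
    fun x => abs_le.2 ⟨le_max_left _ _, max_le (by linarith [K.coe_nonneg]) (min_le_left _ _)⟩, ?_⟩
  filter_upwards [ae_bdd_abs_condExp_of_ae_bdd_abs (m := m) (ae_of_all A hK)] with x hx
  rw [min_eq_right (abs_le.1 hx).2, max_eq_right (abs_le.1 hx).1]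

/-- Under `P₀` the function `d` is orthogonal to all functions measurable for `m`, so under the
nearby law `A` its conditional expectation `g` satisfies `∫ g² ∂A = ∫ g d ∂A ≤ K² δ`. -/
lemma TVClose.abs_integral_mul_le_of_condExp_eq_zero (hm : m ≤ mΩ) [IsFiniteMeasure A]
    [IsFiniteMeasure P₀] {δ : ℝ} (hδ : TVClose A P₀ δ) {u d : Ω → ℝ}
    (hu : StronglyMeasurable[m] u) (hu₂ : MemLp u 2 A) (hd : Measurable d) {K : ℝ≥0}
    (hK : ∀ x, |d x| ≤ K) (hd₀ : P₀[d | m] =ᵐ[P₀] 0) :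
    |∫ x, u x * d x ∂A| ≤ √(∫ x, u x ^ 2 ∂A) * (K * √δ) := by
  obtain ⟨g, hg, hgK, hgd⟩ := exists_stronglyMeasurable_ae_eq_condExp (m := m) (A := A) hK
  have hg' : Measurable g := hg.measurable.mono hm le_rfl
  have pull_out {v : Ω → ℝ} (hv : StronglyMeasurable[m] v) (hv₂ : MemLp v 2 A) :
      ∫ x, v x * d x ∂A = ∫ x, v x * g x ∂A := by
    rw [← integral_mul_condExp hm hv hv₂ (memLp_of_abs_le hd hK)]
    exact integral_congr_ae (hgd.symm.mono fun x hx => congrArg (v x * ·) hx)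
  have orthogonal : ∫ x, g x * d x ∂P₀ = 0 := by
    rw [← integral_mul_condExp hm hg (memLp_of_abs_le hg' hgK) (memLp_of_abs_le hd hK)]
    exact integral_eq_zero_of_ae (hd₀.mono fun x hx => by simp [hx])
  have hg₂ : MemLp g 2 A := memLp_of_abs_le hg' hgK
  have energy : ∫ x, g x ^ 2 ∂A ≤ K ^ 2 * δ := by
    have hgd := hδ (fun x => g x * d x) (K ^ 2) (hg'.mul hd) fun x => by
      rw [abs_mul, NNReal.coe_pow, pow_two]
      exact mul_le_mul (hgK x) (hK x) (abs_nonneg _) K.coe_nonneg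
    rw [orthogonal, sub_zero, pull_out hg hg₂, NNReal.coe_pow] at hgd
    simpa only [pow_two (g _)] using (le_abs_self _).trans hgd
  calc |∫ x, u x * d x ∂A| = |∫ x, u x * g x ∂A| := by rw [pull_out hu hu₂]
    _ ≤ √(∫ x, u x ^ 2 ∂A) * √(∫ x, g x ^ 2 ∂A) := abs_integral_mul_le_sqrt hu₂ hg₂
    _ ≤ √(∫ x, u x ^ 2 ∂A) * (K * √δ) := by
        refine mul_le_mul_of_nonneg_left ((Real.sqrt_le_sqrt energy).trans_eq ?_)
          (Real.sqrt_nonneg _)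
        rw [Real.sqrt_mul (by positivity), Real.sqrt_sq K.coe_nonneg]

lemma condExp_sub_ae_eq_zero (hm : m ≤ mΩ) [IsFiniteMeasure P₀] {h c : Ω → ℝ}
    (hh : Integrable h P₀) (hc : StronglyMeasurable[m] c) (hch : P₀[h | m] =ᵐ[P₀] c) :
    P₀[h - c | m] =ᵐ[P₀] 0 := by
  have hc₁ : Integrable c P₀ := integrable_condExp.congr hch
  filter_upwards [condExp_sub (m := m) hh hc₁, hch] with x hx hx'
  rw [hx, Pi.sub_apply, hx', condExp_of_stronglyMeasurable hm hc hc₁, sub_self, Pi.zero_apply]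

/-- First-order expansion: a density depending on `π` changes the expectation of `h` by its
correlation with `c = E₀[h | π]`, up to a product of two small factors. -/
lemma IsChiSqDensity.abs_integral_withDensity_sub_sub_le [IsFiniteMeasure A]
    [IsFiniteMeasure P₀] {π : Ω → E} (hπ : Measurable π) {v : E → ℝ≥0} {η δ : ℝ}
    (hv : IsChiSqDensity (A.map π) v η) (hδ : TVClose A P₀ δ) {h : Ω → ℝ} {c : E → ℝ}
    (hh : Measurable h) (hc : Measurable c) {C : ℝ≥0} (hC : ∀ x, |h x| ≤ C) (hcC : ∀ e, |c e| ≤ C)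
    (hch : P₀[h | MeasurableSpace.comap π inferInstance] =ᵐ[P₀] fun x => c (π x)) :
    |(∫ x, h x ∂(A.withDensity fun x => v (π x))) - (∫ x, h x ∂A) -
      ∫ e, ((v e : ℝ) - 1) * c e ∂(A.map π)| ≤ √η * (2 * C * √δ) := by
  have hv' := hv.comp hπ
  have hπ_comap := comap_measurable (m := ‹MeasurableSpace E›) π
  have hcπ : Measurable fun x => c (π x) := hc.comp hπ
  have hh₂ : MemLp h 2 A := memLp_of_abs_le hh hC
  have hcπ₂ : MemLp (fun x => c (π x)) 2 A := memLp_of_abs_le hcπ fun x => hcC (π x)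
  have hmeas : Measurable fun e => ((v e : ℝ) - 1) * c e := by
    have := hv.measurable
    fun_prop
  have hdiff : ∫ x, ((v (π x) : ℝ) - 1) * h x ∂A - ∫ x, ((v (π x) : ℝ) - 1) * c (π x) ∂A =
      ∫ x, ((v (π x) : ℝ) - 1) * (h - c ∘ π) x ∂A := by
    rw [← integral_sub (hv'.integrable_mul hh₂) (hv'.integrable_mul hcπ₂)]
    simp only [Pi.sub_apply, Function.comp_apply, mul_sub]
  rw [hv'.integral_withDensity_sub hh₂,
    integral_map hπ.aemeasurable hmeas.aestronglyMeasurable, hdiff]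
  have hu : StronglyMeasurable[MeasurableSpace.comap π inferInstance]
      fun x => (v (π x) : ℝ) - 1 :=
    ((hv.measurable.coe_nnreal_real.sub_const 1).comp hπ_comap).stronglyMeasurable
  have hd₀ := condExp_sub_ae_eq_zero hπ.comap_le
    (memLp_one_iff_integrable.1 (memLp_of_abs_le hh hC)) (hc.comp hπ_comap).stronglyMeasurable hch
  have hdC (x : Ω) : |(h - c ∘ π) x| ≤ (2 * C : ℝ≥0) := by
    rw [NNReal.coe_mul, NNReal.coe_two, two_mul]
    exact (abs_sub _ _).trans (add_le_add (hC x) (hcC (π x)))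
  refine (hδ.abs_integral_mul_le_of_condExp_eq_zero hπ.comap_le hu hv'.memLp
    (hh.sub hcπ) hdC hd₀).trans ?_
  rw [NNReal.coe_mul, NNReal.coe_two]
  exact mul_le_mul_of_nonneg_right (Real.sqrt_le_sqrt hv'.integral_sq_le) (by positivity)

end Projection

section ConditionalIndependence

variable {Ω : Type*}

lemma CondIndepSigma.measureReal_inter_inter {m' m₁ m₂ mΩ : MeasurableSpace Ω} {P : Measure Ω}
    [IsFiniteMeasure P] (hP : CondIndepSigma m' m₁ m₂ P) (hm' : m' ≤ mΩ) (hm₁ : m₁ ≤ mΩ)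
    (hm₂ : m₂ ≤ mΩ) {A B D : Set Ω} (hA : MeasurableSet[m₁] A) (hB : MeasurableSet[m₂] B)
    (hD : MeasurableSet[m'] D) :
    P.real (A ∩ D ∩ B) = ∫ x in A ∩ D, P[B.indicator (fun _ => (1 : ℝ)) | m'] x ∂P := by
  set b := P[B.indicator (fun _ => (1 : ℝ)) | m']
  have hind {s : Set Ω} (hs : MeasurableSet s) : Integrable (s.indicator fun _ => (1 : ℝ)) P :=
    (integrable_const 1).indicator hs
  have hmul : A.indicator (fun _ => (1 : ℝ)) * b = A.indicator b := by
    ext x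
    by_cases hx : x ∈ A <;> simp [hx]
  have hAb : Integrable (A.indicator (fun _ => (1 : ℝ)) * b) P :=
    hmul ▸ integrable_condExp.indicator (hm₁ _ hA)
  calc P.real (A ∩ D ∩ B) = ∫ x in D, (A ∩ B).indicator (fun _ => (1 : ℝ)) x ∂P := by
        rw [setIntegral_indicator ((hm₁ _ hA).inter (hm₂ _ hB)), setIntegral_const, smul_eq_mul,
          mul_one, Set.inter_right_comm, Set.inter_comm]
    _ = ∫ x in D, P[(A ∩ B).indicator (fun _ => (1 : ℝ)) | m'] x ∂P :=
        (setIntegral_condExp hm' (hind ((hm₁ _ hA).inter (hm₂ _ hB))) hD).symm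
    _ = ∫ x in D, P[A.indicator (fun _ => (1 : ℝ)) * b | m'] x ∂P := by
        refine integral_congr_ae (ae_restrict_of_ae ?_)
        exact (hP A B hA hB).trans (condExp_mul_of_stronglyMeasurable_right
          stronglyMeasurable_condExp hAb (hind (hm₁ _ hA))).symm
    _ = ∫ x in A ∩ D, b x ∂P := by
        rw [setIntegral_condExp hm' hAb hD, hmul, setIntegral_indicator (hm₁ _ hA), Set.inter_comm]

variable {m₁ m₂ mΩ : MeasurableSpace Ω} {α β γ : Type*} [MeasurableSpace α] [MeasurableSpace β]
  [MeasurableSpace γ] {P : Measure Ω} [IsFiniteMeasure P] {W : Ω → β} {Z : Ω → γ} {μ : Measure γ}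
  [SFinite μ] {ρ : β × γ → ℝ≥0∞}

lemma measurable_setLIntegral_density (hW : Measurable W) (hρ : Measurable ρ) (B : Set γ) :
    Measurable fun x => ∫⁻ z in B, ρ (W x, z) ∂μ :=
  hρ.lintegral_prod_right'.comp hW

lemma measure_preimage_inter_preimage (hW : Measurable W) (hZ : Measurable Z) (hρ : Measurable ρ)
    (hWZ : P.map (fun x => (W x, Z x)) = ((P.map W).prod μ).withDensity ρ) {D : Set β} {B : Set γ}
    (hD : MeasurableSet D) (hB : MeasurableSet B) :
    P (W ⁻¹' D ∩ Z ⁻¹' B) = ∫⁻ x in W ⁻¹' D, ∫⁻ z in B, ρ (W x, z) ∂μ ∂P := by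
  rw [← Set.mk_preimage_prod, ← Measure.map_apply (hW.prodMk hZ) (hD.prod hB), hWZ,
    withDensity_apply _ (hD.prod hB), ← Measure.prod_restrict, lintegral_prod _ hρ.aemeasurable,
    setLIntegral_map hD hρ.lintegral_prod_right' hW]

lemma lintegral_density_ne_top (hW : Measurable W) (hZ : Measurable Z) (hρ : Measurable ρ)
    (hWZ : P.map (fun x => (W x, Z x)) = ((P.map W).prod μ).withDensity ρ) {B : Set γ}
    (hB : MeasurableSet B) : ∫⁻ x, ∫⁻ z in B, ρ (W x, z) ∂μ ∂P ≠ ∞ := by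
  have htot := measure_preimage_inter_preimage hW hZ hρ hWZ MeasurableSet.univ hB
  rw [Set.preimage_univ, Measure.restrict_univ] at htot
  exact htot ▸ measure_ne_top _ _

lemma setIntegral_toReal_density (hW : Measurable W) (hZ : Measurable Z) (hρ : Measurable ρ)
    (hWZ : P.map (fun x => (W x, Z x)) = ((P.map W).prod μ).withDensity ρ) {B : Set γ}
    (hB : MeasurableSet B) (s : Set Ω) :
    ∫ x in s, (∫⁻ z in B, ρ (W x, z) ∂μ).toReal ∂P =
      (∫⁻ x in s, ∫⁻ z in B, ρ (W x, z) ∂μ ∂P).toReal :=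
  integral_toReal (measurable_setLIntegral_density hW hρ B).aemeasurable <| ae_restrict_of_ae <|
    ae_lt_top (measurable_setLIntegral_density hW hρ B)
      (lintegral_density_ne_top hW hZ hρ hWZ hB)

lemma condExp_indicator_preimage_ae_eq (hW : Measurable W) (hZ : Measurable Z) (hρ : Measurable ρ)
    (hWZ : P.map (fun x => (W x, Z x)) = ((P.map W).prod μ).withDensity ρ) {B : Set γ}
    (hB : MeasurableSet B) :
    (fun x => (∫⁻ z in B, ρ (W x, z) ∂μ).toReal) =ᵐ[P]
      P[(Z ⁻¹' B).indicator (fun _ => (1 : ℝ)) | MeasurableSpace.comap W inferInstance] := by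
  have h_int := integrable_toReal_of_lintegral_ne_top
    (measurable_setLIntegral_density hW hρ B).aemeasurable
    (lintegral_density_ne_top hW hZ hρ hWZ hB)
  refine ae_eq_condExp_of_forall_setIntegral_eq hW.comap_le
    ((integrable_const 1).indicator (hZ hB)) (fun _ _ _ => h_int.integrableOn) ?_
    (measurable_setLIntegral_density (comap_measurable W) hρ
      B).ennreal_toReal.aestronglyMeasurable
  rintro _ ⟨D, hD, rfl⟩ -
  rw [setIntegral_toReal_density hW hZ hρ hWZ hB,
    ← measure_preimage_inter_preimage hW hZ hρ hWZ hD hB, setIntegral_indicator (hZ hB),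
    setIntegral_const, smul_eq_mul, mul_one, measureReal_def]

lemma CondIndepSigma.map_prodMk_eq_withDensity {U : Ω → α}
    (hP : CondIndepSigma (MeasurableSpace.comap W inferInstance) m₁ m₂ P) (hm₁ : m₁ ≤ mΩ)
    (hm₂ : m₂ ≤ mΩ) (hW : Measurable W) (hU : Measurable[m₁] U) (hZ : Measurable[m₂] Z)
    (hρ : Measurable ρ)
    (hWZ : P.map (fun x => (W x, Z x)) = ((P.map W).prod μ).withDensity ρ) :
    P.map (fun x => ((U x, W x), Z x)) =
      ((P.map fun x => (U x, W x)).prod μ).withDensity fun p => ρ (p.1.2, p.2) := by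
  have hU' : Measurable U := hU.mono hm₁ le_rfl
  have hZ' : Measurable Z := hZ.mono hm₂ le_rfl
  refine Measure.ext_prod₃' fun {A D B} hA hD hB => ?_
  have hfin : ∫⁻ x in U ⁻¹' A ∩ W ⁻¹' D, ∫⁻ z in B, ρ (W x, z) ∂μ ∂P ≠ ∞ :=
    ((setLIntegral_le_lintegral _ _).trans_lt
      (lintegral_density_ne_top hW hZ' hρ hWZ hB).lt_top).ne
  have hreal := hP.measureReal_inter_inter hW.comap_le hm₁ hm₂ (hU hA) (hZ hB) ⟨D, hD, rfl⟩
  rw [← integral_congr_ae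
      (ae_restrict_of_ae (condExp_indicator_preimage_ae_eq hW hZ' hρ hWZ hB)),
    setIntegral_toReal_density hW hZ' hρ hWZ hB, measureReal_def,
    ENNReal.toReal_eq_toReal_iff' (measure_ne_top _ _) hfin] at hreal
  rw [Measure.map_apply ((hU'.prodMk hW).prodMk hZ') ((hA.prod hD).prod hB),
    withDensity_apply _ ((hA.prod hD).prod hB), ← Measure.prod_restrict,
    lintegral_prod _ (by fun_prop), setLIntegral_map (hA.prod hD)
      (measurable_setLIntegral_density measurable_snd hρ B) (hU'.prodMk hW)]
  exact hreal

end ConditionalIndependence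

section Resampling

variable {Ω E : Type*} [MeasurableSpace Ω] [MeasurableSpace E] {P₀ : Measure Ω} {ρ : Measure E}
  [IsProbabilityMeasure P₀] [SFinite ρ] {U : Ω × E → Ω} {π : Ω → E}

lemma map_eq_of_measurePreserving_resample (hU : MeasurePreserving U (P₀.prod ρ) P₀)
    (hπ : Measurable π) (hπU : ∀ p, π (U p) = p.2) : P₀.map π = ρ := by
  rw [← hU.map_eq, Measure.map_map hπ hU.measurable, show π ∘ U = Prod.snd from funext hπU,
    measurePreserving_snd.map_eq]

lemma condExp_comap_ae_eq_integral_resample (hU : MeasurePreserving U (P₀.prod ρ) P₀)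
    (hπ : Measurable π) (hπU : ∀ p, π (U p) = p.2) {h : Ω → ℝ} (hh : Measurable h)
    (h_int : Integrable h P₀) :
    P₀[h | MeasurableSpace.comap π inferInstance] =ᵐ[P₀]
      fun x => ∫ w, h (U (w, π x)) ∂P₀ := by
  have hc : StronglyMeasurable fun e => ∫ w, h (U (w, e)) ∂P₀ :=
    (hh.comp hU.measurable).stronglyMeasurable.integral_prod_left'
  have hhU : Integrable (fun p => h (U p)) (P₀.prod ρ) := hU.integrable_comp_of_integrable h_int
  have hlaw : P₀.map π = ρ := map_eq_of_measurePreserving_resample hU hπ hπU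
  have hcint : Integrable (fun x => ∫ w, h (U (w, π x)) ∂P₀) P₀ :=
    (hlaw ▸ hhU.integral_prod_right).comp_measurable hπ
  refine (ae_eq_condExp_of_forall_setIntegral_eq hπ.comap_le h_int
    (fun _ _ _ => hcint.integrableOn) ?_
    (hc.comp_measurable (comap_measurable π)).aestronglyMeasurable).symm
  rintro _ ⟨D, hD, rfl⟩ -
  have hpre : U ⁻¹' (π ⁻¹' D) = Set.univ ×ˢ D := by
    ext p
    simp [hπU]
  calc ∫ x in π ⁻¹' D, ∫ w, h (U (w, π x)) ∂P₀ ∂P₀ = ∫ e in D, ∫ w, h (U (w, e)) ∂P₀ ∂ρ := by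
        rw [← hlaw, setIntegral_map hD hc.aestronglyMeasurable hπ.aemeasurable]
    _ = ∫ p in Set.univ ×ˢ D, h (U p) ∂(P₀.prod ρ) := by
        rw [← Measure.prod_restrict, Measure.restrict_univ, integral_prod_symm]
        rw [← Measure.restrict_univ (μ := P₀), Measure.prod_restrict]
        exact hhU.integrableOn
    _ = ∫ x in π ⁻¹' D, h x ∂P₀ := by
        conv_rhs => rw [← hU.map_eq]
        rw [setIntegral_map (hπ hD) hh.aestronglyMeasurable hU.measurable.aemeasurable, hpre]

end Resampling

section Baseline

variable {𝒳 : Type*} [MeasurableSpace 𝒳] (μ : Measure 𝒳) [IsProbabilityMeasure μ] {T : ℕ}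
  {h : (Fin T → 𝒳) → ℝ} {i j k : Fin T}

instance isProbabilityMeasure_baseline : IsProbabilityMeasure (baseline μ T) := by
  unfold baseline
  infer_instance

lemma map_eval_baseline (i : Fin T) : (baseline μ T).map (fun x => x i) = μ :=
  (measurePreserving_eval (fun _ => μ) i).map_eq

lemma measurePreserving_update (j : Fin T) :
    MeasurePreserving (fun p : (Fin T → 𝒳) × 𝒳 => Function.update p.1 j p.2)
      ((baseline μ T).prod μ) (baseline μ T) := by
  refine ⟨measurable_update', (Measure.pi_eq fun s hs => ?_).symm⟩
  have hpre : (fun p : (Fin T → 𝒳) × 𝒳 => Function.update p.1 j p.2) ⁻¹' (Set.univ.pi s) =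
      Set.univ.pi (Function.update s j Set.univ) ×ˢ s j := by
    ext p
    simp only [Set.mem_preimage, Set.mem_univ_pi, Set.mem_prod]
    rw [Function.forall_update_iff p.1 fun i x => x ∈ s i,
      Function.forall_update_iff s fun i t => p.1 i ∈ t, and_comm]
    simp
  rw [Measure.map_apply measurable_update' (MeasurableSet.univ_pi hs), hpre, Measure.prod_prod,
    baseline, Measure.pi_pi, ← Finset.prod_erase_mul _ _ (Finset.mem_univ j),
    ← Finset.prod_erase_mul _ (fun i => μ (s i)) (Finset.mem_univ j), Function.update_self,
    measure_univ, mul_one]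
  refine congrArg (· * μ (s j)) (Finset.prod_congr rfl fun i hi => ?_)
  rw [Function.update_of_ne (Finset.ne_of_mem_erase hi)]

lemma measurePreserving_update₂ (i j : Fin T) :
    MeasurePreserving (fun p : (Fin T → 𝒳) × (𝒳 × 𝒳) =>
      Function.update (Function.update p.1 i p.2.1) j p.2.2)
      ((baseline μ T).prod (μ.prod μ)) (baseline μ T) :=
  ((measurePreserving_update μ j).comp
    ((measurePreserving_update μ i).prod (MeasurePreserving.id μ))).comp
    (measurePreserving_prodAssoc (baseline μ T) μ μ).symm

lemma measurePreserving_update₃ (i j k : Fin T) :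
    MeasurePreserving (fun p : (Fin T → 𝒳) × (𝒳 × 𝒳 × 𝒳) =>
      Function.update (Function.update (Function.update p.1 i p.2.1) j p.2.2.1) k p.2.2.2)
      ((baseline μ T).prod (μ.prod (μ.prod μ))) (baseline μ T) :=
  ((measurePreserving_update₂ μ j k).comp
    ((measurePreserving_update μ i).prod (MeasurePreserving.id (μ.prod μ)))).comp
    (measurePreserving_prodAssoc (baseline μ T) μ (μ.prod μ)).symm

lemma pairLaw_baseline (hij : i ≠ j) : pairLaw (baseline μ T) i j = μ.prod μ :=
  map_eq_of_measurePreserving_resample (measurePreserving_update₂ μ i j) (by fun_prop)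
    fun p => by simp [hij]

lemma tripleLaw_baseline (hij : i ≠ j) (hik : i ≠ k) (hjk : j ≠ k) :
    tripleLaw (baseline μ T) i j k = μ.prod (μ.prod μ) :=
  map_eq_of_measurePreserving_resample (measurePreserving_update₃ μ i j k) (by fun_prop)
    fun p => by simp [hij, hik, hjk]

lemma condExp_baseline_ae_eq_condE2 (hij : i ≠ j) (hh : Measurable h)
    (h_int : Integrable h (baseline μ T)) :
    (baseline μ T)[h | MeasurableSpace.comap (fun x => (x i, x j)) inferInstance] =ᵐ[baseline μ T]
      fun x => condE2 μ h i j (x i) (x j) :=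
  condExp_comap_ae_eq_integral_resample (π := fun x => (x i, x j))
    (measurePreserving_update₂ μ i j) (by fun_prop) (fun p => by simp [hij]) hh h_int

lemma condExp_baseline_ae_eq_condE3 (hij : i ≠ j) (hik : i ≠ k) (hjk : j ≠ k) (hh : Measurable h)
    (h_int : Integrable h (baseline μ T)) :
    (baseline μ T)[h | MeasurableSpace.comap (fun x => (x i, x j, x k)) inferInstance]
      =ᵐ[baseline μ T] fun x => condE3 μ h i j k (x i) (x j) (x k) :=
  condExp_comap_ae_eq_integral_resample (π := fun x => (x i, x j, x k))
    (measurePreserving_update₃ μ i j k) (by fun_prop) (fun p => by simp [hij, hik, hjk]) hh h_int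

variable {μ} {C : ℝ}

lemma abs_E0_le (hC : ∀ x, |h x| ≤ C) : |E0 μ h| ≤ C := by
  simpa [E0] using
    norm_integral_le_of_norm_le_const (μ := baseline μ T) (f := h) (ae_of_all _ hC)

lemma measurable_condE1 (hh : Measurable h) (i : Fin T) : Measurable (condE1 μ h i) :=
  (hh.comp (measurePreserving_update μ i).measurable).stronglyMeasurable.integral_prod_left'
    |>.measurable

lemma measurable_condE2 (hh : Measurable h) (i j : Fin T) :
    Measurable fun p : 𝒳 × 𝒳 => condE2 μ h i j p.1 p.2 :=
  (hh.comp (measurePreserving_update₂ μ i j).measurable).stronglyMeasurable.integral_prod_left'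
    |>.measurable

lemma measurable_condE3 (hh : Measurable h) (i j k : Fin T) :
    Measurable fun p : 𝒳 × 𝒳 × 𝒳 => condE3 μ h i j k p.1 p.2.1 p.2.2 :=
  (hh.comp (measurePreserving_update₃ μ i j k).measurable).stronglyMeasurable.integral_prod_left'
    |>.measurable

end Baseline

section Splice

variable {𝒳 : Type*} {T : ℕ}

/-- The sequence that follows `x` before time `n` and `w` from time `n` on. -/
def splice (n : ℕ) (x w : Fin T → 𝒳) : Fin T → 𝒳 := fun i => if (i : ℕ) < n then x i else w i

lemma splice_apply_of_lt {n : ℕ} {i : Fin T} (hi : (i : ℕ) < n) (x w : Fin T → 𝒳) :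
    splice n x w i = x i := if_pos hi

lemma splice_apply_of_le {n : ℕ} {i : Fin T} (hi : n ≤ i) (x w : Fin T → 𝒳) :
    splice n x w i = w i := if_neg hi.not_gt

lemma splice_of_le {n : ℕ} (hn : T ≤ n) (x w : Fin T → 𝒳) : splice n x w = x :=
  funext fun i => splice_apply_of_lt (i.isLt.trans_le hn) x w

lemma splice_add_one (k : Fin T) (x w : Fin T → 𝒳) :
    splice (k + 1) x w = Function.update (splice k x w) k (x k) := by
  ext i
  simp only [splice, Function.update_apply, Fin.ext_iff]
  grind

lemma splice_update_right (k : Fin T) (x w : Fin T → 𝒳) (z : 𝒳) :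
    splice k x (Function.update w k z) = Function.update (splice k x w) k z := by
  ext i
  simp only [splice, Function.update_apply, Fin.ext_iff]
  grind

variable [MeasurableSpace 𝒳]

lemma measurable_splice (n : ℕ) :
    Measurable fun p : (Fin T → 𝒳) × (Fin T → 𝒳) => splice n p.1 p.2 := by
  refine measurable_pi_lambda _ fun i => ?_
  by_cases hi : (i : ℕ) < n
  · simp only [splice, if_pos hi]
    fun_prop
  · simp only [splice, if_neg hi]
    fun_prop

lemma measurable_splice_left {i : Fin T} (w : Fin T → 𝒳) :
    Measurable[cylinderEvents {s | s < i}] fun x : Fin T → 𝒳 => splice i x w := by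
  rw [@measurable_pi_iff]
  intro s
  by_cases hs : s < i
  · simp only [splice_apply_of_lt hs]
    exact measurable_cylinderEvent_apply hs
  · simp only [splice_apply_of_le (not_lt.1 hs)]
    exact measurable_const

/-- The law of a sequence whose entries before time `n` are drawn from `P` and whose remaining
entries are independent of them and i.i.d. with law `μ`. -/
noncomputable def spliceLaw (μ : Measure 𝒳) (P : Measure (Fin T → 𝒳)) (n : ℕ) :
    Measure (Fin T → 𝒳) :=
  (P.prod (baseline μ T)).map fun p => splice n p.1 p.2

variable {μ : Measure 𝒳} [IsProbabilityMeasure μ] {P : Measure (Fin T → 𝒳)}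

lemma spliceLaw_of_le {n : ℕ} (hn : T ≤ n) : spliceLaw μ P n = P := by
  simp only [spliceLaw, splice_of_le hn]
  exact measurePreserving_fst.map_eq

lemma lintegral_splice_add_one {k : Fin T} {ρ F : (Fin T → 𝒳) → ℝ≥0∞} (hρ : Measurable ρ)
    (hF : Measurable F) (w : Fin T → 𝒳) (hk : P.map (fun x => (splice k x w, x k)) =
      ((P.map fun x => splice k x w).prod μ).withDensity fun p => ρ (Function.update p.1 k p.2)) :
    ∫⁻ x, F (splice (k + 1) x w) ∂P =
      ∫⁻ x, ∫⁻ z, (ρ * F) (splice k x (Function.update w k z)) ∂μ ∂P := by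
  have hu := measurable_update' (X := fun _ : Fin T => 𝒳) (a := k)
  have hw : Measurable fun x => splice k x w := (measurable_splice k).comp measurable_prodMk_right
  have hFu : Measurable fun p : (Fin T → 𝒳) × 𝒳 => F (Function.update p.1 k p.2) := hF.comp hu
  have hρFu : Measurable fun p : (Fin T → 𝒳) × 𝒳 => (ρ * F) (Function.update p.1 k p.2) :=
    (hρ.mul hF).comp hu
  calc
    _ = ∫⁻ p, F (Function.update p.1 k p.2) ∂(P.map fun x => (splice k x w, x k)) := by
      rw [lintegral_map hFu (hw.prodMk (measurable_pi_apply k))]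
      simp only [splice_add_one]
    _ = ∫⁻ p, (ρ * F) (Function.update p.1 k p.2) ∂((P.map fun x => splice k x w).prod μ) := by
      rw [hk]
      exact lintegral_withDensity_eq_lintegral_mul _ (hρ.comp hu) hFu
    _ = _ := by
      rw [lintegral_prod _ hρFu.aemeasurable, lintegral_map hρFu.lintegral_prod_right' hw]
      simp only [splice_update_right]

variable [IsProbabilityMeasure P]

instance isProbabilityMeasure_spliceLaw (n : ℕ) : IsProbabilityMeasure (spliceLaw μ P n) :=
  Measure.isProbabilityMeasure_map (measurable_splice n).aemeasurable

lemma spliceLaw_one {i : Fin T} (hi : (i : ℕ) = 0) (hP : P.map (fun x => x i) = μ) :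
    spliceLaw μ P 1 = baseline μ T := by
  have hsplice (x w : Fin T → 𝒳) : splice 1 x w = Function.update w i (x i) := by
    have h₀ : splice i x w = w := funext fun j => splice_apply_of_le (by omega) x w
    have h₁ := splice_add_one i x w
    rwa [h₀, hi] at h₁
  have hprod : (P.prod (baseline μ T)).map (fun p => (p.2, p.1 i)) = (baseline μ T).prod μ := by
    rw [← Measure.prod_swap, Measure.map_map (by fun_prop) measurable_swap]
    exact (Measure.map_prod_map _ _ measurable_id (measurable_pi_apply i)).symm.trans
      (by rw [hP, Measure.map_id])
  rw [← (measurePreserving_update μ i).map_eq, ← hprod,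
    Measure.map_map (measurePreserving_update μ i).measurable (by fun_prop), spliceLaw]
  simp only [hsplice]
  rfl

lemma map_pair_spliceLaw {n : ℕ} {i j : Fin T} (hi : (i : ℕ) < n) (hj : (j : ℕ) = n)
    (hP : P.map (fun x => x i) = μ) :
    (spliceLaw μ P n).map (fun x => (x i, x j)) = μ.prod μ := by
  rw [spliceLaw, Measure.map_map (by fun_prop) (measurable_splice n)]
  simp only [Function.comp_def, splice_apply_of_lt hi, splice_apply_of_le hj.ge]
  exact (Measure.map_prod_map _ _ (measurable_pi_apply i) (measurable_pi_apply j)).symm.trans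
    (by rw [hP, map_eval_baseline])

lemma map_triple_spliceLaw {n : ℕ} {i j k : Fin T} (hi : (i : ℕ) < n) (hj : (j : ℕ) < n)
    (hk : (k : ℕ) = n) :
    (spliceLaw μ P n).map (fun x => ((x i, x j), x k)) = (pairLaw P i j).prod μ := by
  rw [spliceLaw, Measure.map_map (by fun_prop) (measurable_splice n)]
  simp only [Function.comp_def, splice_apply_of_lt hi, splice_apply_of_lt hj,
    splice_apply_of_le hk.ge]
  exact (Measure.map_prod_map P (baseline μ T) (f := fun x => (x i, x j)) (by fun_prop)
    (measurable_pi_apply k)).symm.trans (by rw [map_eval_baseline])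

lemma spliceLaw_add_one_eq_withDensity {k : Fin T} {ρ : (Fin T → 𝒳) → ℝ≥0∞} (hρ : Measurable ρ)
    (hk : ∀ w, P.map (fun x => (splice k x w, x k)) =
      ((P.map fun x => splice k x w).prod μ).withDensity
        fun p => ρ (Function.update p.1 k p.2)) :
    spliceLaw μ P (k + 1) = (spliceLaw μ P k).withDensity ρ := by
  refine Measure.ext_of_lintegral _ fun F hF => ?_
  have hS := measurable_splice (𝒳 := 𝒳) (T := T)
  have hu := measurable_update' (X := fun _ : Fin T => 𝒳) (a := k)
  have hG : Measurable fun p : (Fin T → 𝒳) × (Fin T → 𝒳) => (ρ * F) (splice k p.1 p.2) :=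
    (hρ.mul hF).comp (hS k)
  have resample (x : Fin T → 𝒳) :
      ∫⁻ w, ∫⁻ z, (ρ * F) (splice k x (Function.update w k z)) ∂μ ∂(baseline μ T) =
        ∫⁻ w, (ρ * F) (splice k x w) ∂(baseline μ T) := by
    have hGx : Measurable fun w => (ρ * F) (splice k x w) := hG.comp measurable_prodMk_left
    rw [← (measurePreserving_update μ k).lintegral_comp hGx]
    exact (lintegral_prod _ (hGx.comp hu).aemeasurable).symm
  calc
    _ = ∫⁻ w, ∫⁻ x, F (splice (k + 1) x w) ∂P ∂(baseline μ T) := by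
      rw [spliceLaw, lintegral_map hF (hS _)]
      exact lintegral_prod_symm _ (hF.comp (hS _)).aemeasurable
    _ = ∫⁻ w, ∫⁻ x, ∫⁻ z, (ρ * F) (splice k x (Function.update w k z)) ∂μ ∂P ∂(baseline μ T) :=
      lintegral_congr fun w => lintegral_splice_add_one hρ hF w (hk w)
    _ = ∫⁻ x, ∫⁻ w, (ρ * F) (splice k x w) ∂(baseline μ T) ∂P := by
      rw [lintegral_lintegral_swap, lintegral_congr resample]
      have hGu : Measurable fun q : ((Fin T → 𝒳) × (Fin T → 𝒳)) × 𝒳 =>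
          (ρ * F) (splice k q.1.2 (Function.update q.1.1 k q.2)) :=
        hG.comp (measurable_fst.snd.prodMk (hu.comp (measurable_fst.fst.prodMk measurable_snd)))
      exact hGu.lintegral_prod_right'.aemeasurable
    _ = _ := by
      rw [lintegral_withDensity_eq_lintegral_mul _ hρ hF, spliceLaw,
        lintegral_map (hρ.mul hF) (hS _), lintegral_prod _ hG.aemeasurable]

end Splice

section Dependence

variable {𝒳 : Type*} [MeasurableSpace 𝒳] {T : ℕ} {μ : Measure 𝒳} {P : Measure (Fin T → 𝒳)}

lemma IsDependent.condIndepSigma_one (hP : IsDependent 1 P) (j : Fin T) :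
    CondIndepSigma (MeasurableSpace.comap (fun x : Fin T → 𝒳 => x j) inferInstance)
      (cylinderEvents {s | s < j}) (cylinderEvents {s | j < s}) P := by
  have hj : {s : Fin T | (j : ℕ) ≤ s ∧ (s : ℕ) < j + 1} = {j} := by
    ext s
    simp only [Set.mem_ofPred_eq, Set.mem_singleton_iff, Fin.ext_iff]
    omega
  have h := hP j
  rwa [hj, cylinderEvents, iSup_singleton] at h

lemma IsDependent.condIndepSigma_two (hP : IsDependent 2 P) {i j : Fin T} (hij : (j : ℕ) = i + 1) :
    CondIndepSigma (MeasurableSpace.comap (fun x : Fin T → 𝒳 => (x i, x j)) inferInstance)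
      (cylinderEvents {s | s < i}) (cylinderEvents {s | j < s}) P := by
  have hΔ : {s : Fin T | (i : ℕ) ≤ s ∧ (s : ℕ) < i + 2} = {i, j} := by
    ext s
    simp only [Set.mem_ofPred_eq, Set.mem_insert_iff, Set.mem_singleton_iff, Fin.ext_iff]
    omega
  have hfuture : {s : Fin T | (i : ℕ) + 2 ≤ s} = {s | j < s} := by
    ext s
    simp only [Set.mem_ofPred_eq, Fin.lt_def]
    omega
  have h := hP i
  rw [hΔ, hfuture, cylinderEvents, iSup_pair, ← MeasurableSpace.comap_prodMk] at h
  exact h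

lemma IsStationary.pairLaw_eq (hP : IsStationary P) {i j i' j' : Fin T} (hij : (j : ℕ) = i + 1)
    (hij' : (j' : ℕ) = i' + 1) : pairLaw P i j = pairLaw P i' j' := by
  have initial (n : ℕ) (hn : n + 1 < T) :
      pairLaw P ⟨n, by omega⟩ ⟨n + 1, hn⟩ = pairLaw P ⟨0, by omega⟩ ⟨1, by omega⟩ := by
    have h := congrArg (fun ν => ν.map fun y : Fin 2 → 𝒳 => (y 0, y 1)) (hP 2 n (by omega))
    rwa [Measure.map_map (by fun_prop) (by fun_prop),
      Measure.map_map (by fun_prop) (by fun_prop)] at h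
  obtain ⟨j, hj⟩ := j
  obtain rfl : j = i + 1 := hij
  obtain ⟨j', hj'⟩ := j'
  obtain rfl : j' = i' + 1 := hij'
  exact (initial i hj).trans (initial i' hj').symm

lemma IsStationary.tripleLaw_eq (hP : IsStationary P) {i j k i' j' k' : Fin T}
    (hij : (j : ℕ) = i + 1) (hjk : (k : ℕ) = j + 1) (hij' : (j' : ℕ) = i' + 1)
    (hjk' : (k' : ℕ) = j' + 1) : tripleLaw P i j k = tripleLaw P i' j' k' := by
  have initial (n : ℕ) (hn : n + 2 < T) :
      tripleLaw P ⟨n, by omega⟩ ⟨n + 1, by omega⟩ ⟨n + 2, hn⟩ =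
        tripleLaw P ⟨0, by omega⟩ ⟨1, by omega⟩ ⟨2, by omega⟩ := by
    have h := congrArg (fun ν => ν.map fun y : Fin 3 → 𝒳 => (y 0, y 1, y 2)) (hP 3 n (by omega))
    rwa [Measure.map_map (by fun_prop) (by fun_prop),
      Measure.map_map (by fun_prop) (by fun_prop)] at h
  obtain ⟨j, hj⟩ := j
  obtain rfl : j = i + 1 := hij
  obtain ⟨k, hk⟩ := k
  obtain rfl : k = i + 2 := hjk
  obtain ⟨j', hj'⟩ := j'
  obtain rfl : j' = i' + 1 := hij'
  obtain ⟨k', hk'⟩ := k'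
  obtain rfl : k' = i' + 2 := hjk'
  exact (initial i hk).trans (initial i' hk').symm

lemma map_fst_pairLaw {i j : Fin T} : (pairLaw P i j).map Prod.fst = P.map fun x => x i :=
  Measure.map_map measurable_fst (by fun_prop)

lemma map_snd_pairLaw {i j : Fin T} : (pairLaw P i j).map Prod.snd = P.map fun x => x j :=
  Measure.map_map measurable_snd (by fun_prop)

lemma map_pair_tripleLaw {i j k : Fin T} :
    (tripleLaw P i j k).map (fun p => (p.1, p.2.1)) = pairLaw P i j :=
  Measure.map_map (by fun_prop) (by fun_prop)

lemma map_snd_tripleLaw {i j k : Fin T} : (tripleLaw P i j k).map Prod.snd = pairLaw P j k :=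
  Measure.map_map measurable_snd (by fun_prop)

end Dependence

section MarkovTriple

variable {𝒳 : Type*} [MeasurableSpace 𝒳] {μ : Measure 𝒳} {L : 𝒳 × 𝒳 → ℝ≥0}

/-- The law of three consecutive states of the stationary Markov chain whose pairs of consecutive
states have density `L` with respect to `μ.prod μ`. -/
noncomputable def markovTriple (μ : Measure 𝒳) (L : 𝒳 × 𝒳 → ℝ≥0) : Measure (𝒳 × 𝒳 × 𝒳) :=
  (μ.prod (μ.prod μ)).withDensity fun p => L (p.1, p.2.1) * L p.2

lemma map_prodAssoc_withDensity [SFinite μ] (hL : Measurable L) :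
    ((((μ.prod μ).withDensity fun p => L p).prod μ).withDensity fun p => L (p.1.2, p.2)).map
      MeasurableEquiv.prodAssoc = markovTriple μ L := by
  rw [prod_withDensity_left (by fun_prop), ← withDensity_mul _ (by fun_prop) (by fun_prop),
    markovTriple, ← Measure.prodAssoc_prod, ← map_withDensity_comp
      MeasurableEquiv.prodAssoc.measurable (by fun_prop)]
  rfl

lemma IsOneDependentCounterpart.tripleLaw_eq_markovTriple [SFinite μ] {T : ℕ}
    {P Q : Measure (Fin T → 𝒳)} (hQ : IsOneDependentCounterpart Q P) (hL : Measurable L)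
    {i j k : Fin T} (hij : (j : ℕ) = i + 1) (hjk : (k : ℕ) = j + 1)
    (hP : P.map (fun x => x j) = μ)
    (hPij : pairLaw P i j = (μ.prod μ).withDensity fun p => L p)
    (hPjk : pairLaw P j k = (μ.prod μ).withDensity fun p => L p) :
    tripleLaw Q i j k = markovTriple μ L := by
  have := hQ.isProbabilityMeasure
  have hQj : Q.map (fun x => x j) = μ := by
    rw [← map_fst_pairLaw (j := k), hQ.pairLaw_eq j k hjk, map_fst_pairLaw, hP]
  have hstep : Q.map (fun x => (x j, x k)) =
      ((Q.map fun x => x j).prod μ).withDensity fun p => L p := by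
    rw [hQj, ← hPjk, ← hQ.pairLaw_eq j k hjk, pairLaw]
  have h := (hQ.isDependent.condIndepSigma_one j).map_prodMk_eq_withDensity
    cylinderEvents_le_pi cylinderEvents_le_pi (measurable_pi_apply j)
    (measurable_cylinderEvent_apply (i := i) (Set.mem_ofPred_eq ▸ Fin.lt_def.2 (by omega)))
    (measurable_cylinderEvent_apply (i := k) (Set.mem_ofPred_eq ▸ Fin.lt_def.2 (by omega)))
    (by fun_prop) hstep
  rw [← map_prodAssoc_withDensity hL, ← hPij, ← hQ.pairLaw_eq i j hij, pairLaw, ← h,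
    Measure.map_map MeasurableEquiv.prodAssoc.measurable (by fun_prop)]
  rfl

end MarkovTriple

section PerturbedChain

variable {𝒳 : Type*} [MeasurableSpace 𝒳] {T : ℕ} {μ : Measure 𝒳} {η₁ η₂ : ℝ}
  {L : 𝒳 × 𝒳 → ℝ≥0} {V : 𝒳 × 𝒳 × 𝒳 → ℝ≥0} {P : Measure (Fin T → 𝒳)} {i j k : Fin T}

/-- The law halfway between `spliceLaw μ P k` and `spliceLaw μ P (k + 1)`: entry `k` depends on
entry `j`, in the applications its predecessor, through the pair density `L`. -/
noncomputable def halfSpliceLaw (μ : Measure 𝒳) (P : Measure (Fin T → 𝒳)) (L : 𝒳 × 𝒳 → ℝ≥0)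
    (j k : Fin T) : Measure (Fin T → 𝒳) :=
  (spliceLaw μ P k).withDensity fun x => L (x j, x k)

/-- `P` is the law of a 2-dependent sequence with marginal law `μ` in which every pair of
consecutive states has the density `L` with respect to the i.i.d. law, and every triple the density
`V` with respect to the Markov law with the same pairs; `L` and `V` are within `χ²`-distance `η₁`
and `η₂` of the constant `1`. -/
structure IsPerturbedChain (μ : Measure 𝒳) (η₁ η₂ : ℝ) (L : 𝒳 × 𝒳 → ℝ≥0)
    (V : 𝒳 × 𝒳 × 𝒳 → ℝ≥0) (P : Measure (Fin T → 𝒳)) : Prop where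
  isProbabilityMeasure : IsProbabilityMeasure P
  isDependent : IsDependent 2 P
  marginal : ∀ i, P.map (fun x => x i) = μ
  pairLaw_eq : ∀ i j : Fin T, (j : ℕ) = i + 1 → pairLaw P i j = (μ.prod μ).withDensity fun p => L p
  tripleLaw_eq : ∀ i j k : Fin T, (j : ℕ) = i + 1 → (k : ℕ) = j + 1 →
    tripleLaw P i j k = (markovTriple μ L).withDensity fun p => V p
  isChiSqDensity_pair : IsChiSqDensity (μ.prod μ) L η₁
  isChiSqDensity_triple : IsChiSqDensity (markovTriple μ L) V η₂
  map_pair_markovTriple :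
    (markovTriple μ L).map (fun p => (p.1, p.2.1)) = (μ.prod μ).withDensity fun p => L p
  map_snd_markovTriple :
    (markovTriple μ L).map Prod.snd = (μ.prod μ).withDensity fun p => L p

lemma IsFeasible.exists_isPerturbedChain [IsProbabilityMeasure μ] (hP : IsFeasible μ η₁ η₂ P)
    (hT : 2 < T) (hη₁ : 0 ≤ η₁) (hη₂ : 0 ≤ η₂) :
    ∃ L V, IsPerturbedChain μ η₁ η₂ L V P := by
  have := hP.isProbabilityMeasure
  obtain ⟨Q, hQ, hPQ⟩ := hP.lagTwo
  have := hQ.isProbabilityMeasure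
  let i : Fin T := ⟨0, by omega⟩
  let j : Fin T := ⟨1, by omega⟩
  let k : Fin T := ⟨2, hT⟩
  have hpair : IsProbabilityMeasure (pairLaw P i j) :=
    Measure.isProbabilityMeasure_map (by fun_prop)
  have htriple {A : Measure (Fin T → 𝒳)} [IsProbabilityMeasure A] :
      IsProbabilityMeasure (tripleLaw A i j k) := Measure.isProbabilityMeasure_map (by fun_prop)
  have hphi := hP.lagOne i j rfl
  rw [phiSq, map_fst_pairLaw, map_snd_pairLaw, hP.marginal, hP.marginal] at hphi
  obtain ⟨L, hL, hL_eq⟩ := exists_density_of_chiSq_le hη₁ hphi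
  obtain ⟨V, hV, hV_eq⟩ := exists_density_of_chiSq_le hη₂ (hPQ i j k rfl rfl)
  have hpairs (i' j' : Fin T) (hij : (j' : ℕ) = i' + 1) :
      pairLaw P i' j' = (μ.prod μ).withDensity fun p => L p :=
    (hP.isStationary.pairLaw_eq hij rfl).trans hL_eq
  have hmarkov := hQ.tripleLaw_eq_markovTriple hL.measurable (i := i) (j := j) (k := k) rfl rfl
    (hP.marginal j) hL_eq (hpairs j k rfl)
  rw [hmarkov] at hV hV_eq
  refine ⟨L, V, ‹_›, hP.isDependent, hP.marginal, hpairs, fun i' j' k' hij hjk =>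
    (hP.isStationary.tripleLaw_eq hij hjk rfl rfl).trans hV_eq, hL, hV, ?_, ?_⟩
  · rw [← hmarkov, map_pair_tripleLaw, hQ.pairLaw_eq i j rfl, hL_eq]
  · rw [← hmarkov, map_snd_tripleLaw, hQ.pairLaw_eq j k rfl, hpairs j k rfl]

lemma map_comp_prodMk_eq_withDensity {Ω α β γ : Type*} [MeasurableSpace Ω] [MeasurableSpace α]
    [MeasurableSpace β] [MeasurableSpace γ] {P : Measure Ω} [IsFiniteMeasure P] {μ : Measure γ}
    [SFinite μ] {Y : Ω → α} {Z : Ω → γ} {G : α → β} {ρ : β × γ → ℝ≥0∞} (hY : Measurable Y)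
    (hZ : Measurable Z) (hG : Measurable G) (hρ : Measurable ρ)
    (h : P.map (fun x => (Y x, Z x)) =
      ((P.map Y).prod μ).withDensity fun p => ρ (G p.1, p.2)) :
    P.map (fun x => (G (Y x), Z x)) = ((P.map fun x => G (Y x)).prod μ).withDensity ρ := by
  have hprod : ((P.map Y).prod μ).map (Prod.map G id) = (P.map fun x => G (Y x)).prod μ := by
    rw [← Measure.map_prod_map _ _ hG measurable_id, Measure.map_id, Measure.map_map hG hY]
    rfl
  rw [← hprod, ← map_withDensity_comp (hG.prodMap measurable_id) hρ]
  simp only [Prod.map, id]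
  rw [← h, Measure.map_map (by fun_prop) (by fun_prop)]
  rfl

namespace IsPerturbedChain

variable (hP : IsPerturbedChain μ η₁ η₂ L V P)
include hP

lemma map_triple_eq_withDensity [SFinite μ] (hij : (j : ℕ) = i + 1) (hjk : (k : ℕ) = j + 1) :
    P.map (fun x => ((x i, x j), x k)) = ((pairLaw P i j).prod μ).withDensity
      fun p => L (p.1.2, p.2) * V (p.1.1, p.1.2, p.2) := by
  have hL := hP.isChiSqDensity_pair.measurable
  have hV := hP.isChiSqDensity_triple.measurable
  refine MeasurableEquiv.prodAssoc.map_measurableEquiv_injective ?_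
  rw [Measure.map_map MeasurableEquiv.prodAssoc.measurable (by fun_prop)]
  change tripleLaw P i j k = _
  rw [hP.tripleLaw_eq i j k hij hjk, ← map_prodAssoc_withDensity hL, ← map_withDensity_comp
    MeasurableEquiv.prodAssoc.measurable (by fun_prop), ← hP.pairLaw_eq i j hij]
  exact congrArg _ (withDensity_mul _ (by fun_prop) (hV.coe_nnreal_ennreal.comp
    MeasurableEquiv.prodAssoc.measurable)).symm

variable [IsProbabilityMeasure μ]

lemma spliceLaw_two (hi : (i : ℕ) = 0) (hj : (j : ℕ) = 1) :
    spliceLaw μ P 2 = halfSpliceLaw μ P L i j := by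
  have := hP.isProbabilityMeasure
  have hL := hP.isChiSqDensity_pair.measurable
  have hρ : Measurable fun x : Fin T → 𝒳 => (L (x i, x j) : ℝ≥0∞) := by fun_prop
  have hne : i ≠ j := Fin.ne_of_val_ne (by omega)
  have hstep := spliceLaw_add_one_eq_withDensity (μ := μ) (P := P) (k := j) hρ fun w => ?_
  · rw [halfSpliceLaw, ← hstep, hj]
  have hsplice (x : Fin T → 𝒳) : splice j x w = Function.update w i (x i) := by
    rw [show (j : ℕ) = i + 1 by omega, splice_add_one,
      show splice i x w = w from funext fun s => splice_apply_of_le (by omega) x w]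
  simp only [hsplice]
  refine map_comp_prodMk_eq_withDensity (Y := fun x : Fin T → 𝒳 => x i)
    (G := fun a => Function.update w i a) (by fun_prop) (by fun_prop) (measurable_update w)
    (hρ.comp measurable_update') ?_
  simp only [Function.update_self, Function.update_of_ne hne, hP.marginal i]
  exact hP.pairLaw_eq i j (by omega)

lemma spliceLaw_add_one (hij : (j : ℕ) = i + 1) (hjk : (k : ℕ) = j + 1) :
    spliceLaw μ P (k + 1) =
      (halfSpliceLaw μ P L j k).withDensity fun x => V (x i, x j, x k) := by
  have := hP.isProbabilityMeasure
  have hL := hP.isChiSqDensity_pair.measurable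
  have hV := hP.isChiSqDensity_triple.measurable
  have hρ : Measurable fun x : Fin T → 𝒳 =>
    (L (x j, x k) : ℝ≥0∞) * V (x i, x j, x k) := by fun_prop
  have hne_ij : i ≠ j := Fin.ne_of_val_ne (by omega)
  have hne_ik : i ≠ k := Fin.ne_of_val_ne (by omega)
  have hne_jk : j ≠ k := Fin.ne_of_val_ne (by omega)
  rw [halfSpliceLaw, ← withDensity_mul _ (by fun_prop) (by fun_prop)]
  refine spliceLaw_add_one_eq_withDensity hρ fun w => ?_
  have hsplice (x : Fin T → 𝒳) : splice k x w =
      Function.update (Function.update (splice i x w) i (x i)) j (x j) := by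
    rw [hjk, splice_add_one, hij, splice_add_one]
  have hdensity := (hP.isDependent.condIndepSigma_two hij).map_prodMk_eq_withDensity (μ := μ)
    (ρ := fun p => L (p.1.2, p.2) * V (p.1.1, p.1.2, p.2)) cylinderEvents_le_pi
    cylinderEvents_le_pi (by fun_prop) (measurable_splice_left w)
    (measurable_cylinderEvent_apply (i := k) (Set.mem_ofPred_eq ▸ Fin.lt_def.2 (by omega)))
    (by fun_prop) (hP.map_triple_eq_withDensity hij hjk)
  have hupdate : Measurable fun p : (Fin T → 𝒳) × 𝒳 × 𝒳 =>
      Function.update (Function.update p.1 i p.2.1) j p.2.2 :=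
    measurable_update'.comp ((measurable_update'.comp (measurable_fst.prodMk
      measurable_snd.fst)).prodMk measurable_snd.snd)
  simp only [hsplice]
  refine map_comp_prodMk_eq_withDensity (Y := fun x => (splice i x w, x i, x j))
    (G := fun p => Function.update (Function.update p.1 i p.2.1) j p.2.2)
    (((measurable_splice_left w).mono cylinderEvents_le_pi le_rfl).prodMk (by fun_prop))
    (by fun_prop) hupdate
    (hρ.comp measurable_update') ?_
  simpa only [Function.update_self, Function.update_of_ne hne_ij, Function.update_of_ne hne_ik,
    Function.update_of_ne hne_jk, Pi.mul_apply] using hdensity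

end IsPerturbedChain

end PerturbedChain

section Closeness

variable {𝒳 : Type*} [MeasurableSpace 𝒳] {T : ℕ} {μ : Measure 𝒳} [IsProbabilityMeasure μ]
  {η₁ η₂ : ℝ} {L : 𝒳 × 𝒳 → ℝ≥0} {V : 𝒳 × 𝒳 × 𝒳 → ℝ≥0} {P : Measure (Fin T → 𝒳)} {i j k : Fin T}

namespace IsPerturbedChain

variable (hP : IsPerturbedChain μ η₁ η₂ L V P)
include hP

lemma isChiSqDensity_map_spliceLaw (hjk : (k : ℕ) = j + 1) :
    IsChiSqDensity ((spliceLaw μ P k).map fun x => (x j, x k)) L η₁ := by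
  have := hP.isProbabilityMeasure
  rw [map_pair_spliceLaw (by omega) rfl (hP.marginal j)]
  exact hP.isChiSqDensity_pair

lemma pairLaw_halfSpliceLaw (hjk : (k : ℕ) = j + 1) :
    pairLaw (halfSpliceLaw μ P L j k) j k = pairLaw P j k := by
  have := hP.isProbabilityMeasure
  have hL := hP.isChiSqDensity_pair.measurable
  rw [halfSpliceLaw, pairLaw, map_withDensity_comp (f := fun p => (L p : ℝ≥0∞)) (by fun_prop)
    (by fun_prop), map_pair_spliceLaw (by omega) rfl (hP.marginal j), hP.pairLaw_eq j k hjk]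

lemma isProbabilityMeasure_halfSpliceLaw (hjk : (k : ℕ) = j + 1) :
    IsProbabilityMeasure (halfSpliceLaw μ P L j k) := by
  have := hP.isProbabilityMeasure
  have : IsProbabilityMeasure ((halfSpliceLaw μ P L j k).map fun x => (x j, x k)) := by
    change IsProbabilityMeasure (pairLaw (halfSpliceLaw μ P L j k) j k)
    rw [hP.pairLaw_halfSpliceLaw hjk]
    exact Measure.isProbabilityMeasure_map (by fun_prop)
  exact Measure.isProbabilityMeasure_of_map fun x => (x j, x k)

lemma tripleLaw_halfSpliceLaw (hij : (j : ℕ) = i + 1) (hjk : (k : ℕ) = j + 1) :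
    tripleLaw (halfSpliceLaw μ P L j k) i j k = markovTriple μ L := by
  have := hP.isProbabilityMeasure
  have hL := hP.isChiSqDensity_pair.measurable
  have h := map_withDensity_comp (A := spliceLaw μ P k) (π := fun x => ((x i, x j), x k))
    (f := fun p => (L (p.1.2, p.2) : ℝ≥0∞)) (by fun_prop) (by fun_prop)
  rw [map_triple_spliceLaw (by omega) (by omega) rfl, hP.pairLaw_eq i j hij] at h
  rw [← map_prodAssoc_withDensity hL, ← h,
    Measure.map_map MeasurableEquiv.prodAssoc.measurable (by fun_prop)]
  rfl

lemma tvClose_halfSpliceLaw (hjk : (k : ℕ) = j + 1) :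
    TVClose (halfSpliceLaw μ P L j k) (spliceLaw μ P k) √η₁ := by
  have := hP.isProbabilityMeasure
  exact ((hP.isChiSqDensity_map_spliceLaw hjk).comp (by fun_prop)).tvClose

lemma isChiSqDensity_tripleLaw_halfSpliceLaw (hij : (j : ℕ) = i + 1) (hjk : (k : ℕ) = j + 1) :
    IsChiSqDensity (tripleLaw (halfSpliceLaw μ P L j k) i j k) V η₂ := by
  rw [hP.tripleLaw_halfSpliceLaw hij hjk]
  exact hP.isChiSqDensity_triple

lemma tvClose_spliceLaw_add_one (hij : (j : ℕ) = i + 1) (hjk : (k : ℕ) = j + 1) :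
    TVClose (spliceLaw μ P (k + 1)) (halfSpliceLaw μ P L j k) √η₂ := by
  have := hP.isProbabilityMeasure_halfSpliceLaw hjk
  rw [hP.spliceLaw_add_one hij hjk]
  exact ((hP.isChiSqDensity_tripleLaw_halfSpliceLaw hij hjk).comp (by fun_prop)).tvClose

lemma tvClose_spliceLaw_add_one_baseline {n : ℕ} (hn : n < T) :
    TVClose (spliceLaw μ P (n + 1)) (baseline μ T) (n * (√η₁ + √η₂)) := by
  have := hP.isProbabilityMeasure
  induction n with
  | zero =>
    rw [zero_add, spliceLaw_one (i := ⟨0, hn⟩) rfl (hP.marginal _), Nat.cast_zero, zero_mul]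
    exact .refl _
  | succ n ih =>
    let j : Fin T := ⟨n, by omega⟩
    let k : Fin T := ⟨n + 1, hn⟩
    have hhalf : TVClose (spliceLaw μ P (n + 2)) (halfSpliceLaw μ P L j k) √η₂ := by
      rcases n with _ | m
      · rw [hP.spliceLaw_two (i := j) (j := k) rfl rfl]
        exact (TVClose.refl _).mono (Real.sqrt_nonneg _)
      · exact hP.tvClose_spliceLaw_add_one (i := ⟨m, by omega⟩) (j := j) (k := k) rfl rfl
    refine ((hhalf.trans (hP.tvClose_halfSpliceLaw (j := j) (k := k) rfl)).trans
      (ih (by omega))).mono (le_of_eq ?_)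
    push_cast
    ring

lemma tvClose_spliceLaw_baseline (hjk : (k : ℕ) = j + 1) :
    TVClose (spliceLaw μ P k) (baseline μ T) (T * (√η₁ + √η₂)) := by
  rw [hjk]
  exact (hP.tvClose_spliceLaw_add_one_baseline (by omega)).mono (by gcongr; omega)

lemma tvClose_halfSpliceLaw_baseline (hjk : (k : ℕ) = j + 1) :
    TVClose (halfSpliceLaw μ P L j k) (baseline μ T) (T * (√η₁ + √η₂)) := by
  have hbase := hP.tvClose_spliceLaw_add_one_baseline (n := j) (by omega)
  rw [← hjk] at hbase
  refine ((hP.tvClose_halfSpliceLaw hjk).trans hbase).mono ?_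
  have hjT : (j : ℝ) + 1 ≤ T := by exact_mod_cast j.2
  nlinarith [Real.sqrt_nonneg η₁, Real.sqrt_nonneg η₂]

end IsPerturbedChain

end Closeness

section Interaction

variable {𝒳 : Type*} [MeasurableSpace 𝒳] {T : ℕ} {μ : Measure 𝒳}
  {h : (Fin T → 𝒳) → ℝ} {C : ℝ≥0}

lemma R_eq_sum (hT : 0 < T) (x y : 𝒳) :
    R μ h x y = ∑ t : Fin (T - 1), (condE2 μ h ⟨t, by omega⟩ ⟨t + 1, by omega⟩ x y
      - condE1 μ h ⟨t, by omega⟩ x - condE1 μ h ⟨t + 1, by omega⟩ y + E0 μ h) := by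
  rw [Finset.sum_add_distrib, Finset.sum_sub_distrib, Finset.sum_sub_distrib, Finset.sum_const,
    Finset.card_univ, Fintype.card_fin, nsmul_eq_mul, Nat.cast_pred hT, R]

lemma S_eq_sum (x y z : 𝒳) :
    S μ h x y z = ∑ t : Fin (T - 2),
      (condE3 μ h ⟨t, by omega⟩ ⟨t + 1, by omega⟩ ⟨t + 2, by omega⟩ x y z
        - condE2 μ h ⟨t, by omega⟩ ⟨t + 1, by omega⟩ x y
        - condE2 μ h ⟨t + 1, by omega⟩ ⟨t + 2, by omega⟩ y z
        + condE1 μ h ⟨t + 1, by omega⟩ y) := by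
  rw [Finset.sum_add_distrib, Finset.sum_sub_distrib, Finset.sum_sub_distrib, S]

variable [IsProbabilityMeasure μ]

lemma measurable_R (hh : Measurable h) : Measurable fun p : 𝒳 × 𝒳 => R μ h p.1 p.2 :=
  (((Finset.measurable_fun_sum _ fun _ _ => measurable_condE2 hh _ _).sub
    (Finset.measurable_fun_sum _ fun _ _ => (measurable_condE1 hh _).comp measurable_fst)).sub
    (Finset.measurable_fun_sum _ fun _ _ => (measurable_condE1 hh _).comp measurable_snd)).add
    measurable_const

lemma measurable_S (hh : Measurable h) :
    Measurable fun p : 𝒳 × 𝒳 × 𝒳 => S μ h p.1 p.2.1 p.2.2 :=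
  (((Finset.measurable_fun_sum _ fun _ _ => measurable_condE3 hh _ _ _).sub
    (Finset.measurable_fun_sum _ fun _ _ => (measurable_condE2 hh _ _).comp
      (f := fun p : 𝒳 × 𝒳 × 𝒳 => (p.1, p.2.1)) (by fun_prop))).sub
    (Finset.measurable_fun_sum _ fun _ _ => (measurable_condE2 hh _ _).comp
      measurable_snd)).add
    (Finset.measurable_fun_sum _ fun _ _ => (measurable_condE1 hh _).comp
      (measurable_fst.comp measurable_snd))

lemma abs_sum_sub_sub_add_le {n : ℕ} (hn : n ≤ T) {a b c d : Fin n → ℝ} (ha : ∀ t, |a t| ≤ C)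
    (hb : ∀ t, |b t| ≤ C) (hc : ∀ t, |c t| ≤ C) (hd : ∀ t, |d t| ≤ C) :
    |∑ t, (a t - b t - c t + d t)| ≤ (4 * T * C : ℝ≥0) := by
  have hterm (t : Fin n) : |a t - b t - c t + d t| ≤ 4 * C := by
    have := abs_add_le (a t - b t - c t) (d t)
    have := abs_sub (a t - b t) (c t)
    linarith [abs_sub (a t) (b t), ha t, hb t, hc t, hd t]
  calc |∑ t, (a t - b t - c t + d t)| ≤ ∑ t, |a t - b t - c t + d t| :=
        Finset.abs_sum_le_sum_abs _ _
    _ ≤ ∑ _ : Fin n, (4 * C : ℝ) := Finset.sum_le_sum fun t _ => hterm t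
    _ = n * (4 * C) := by
        rw [Finset.sum_const, Finset.card_univ, Fintype.card_fin, nsmul_eq_mul]
    _ ≤ T * (4 * C) := by gcongr
    _ = (4 * T * C : ℝ≥0) := by push_cast; ring

lemma abs_R_le (hT : 0 < T) (hC : ∀ x, |h x| ≤ C) (x y : 𝒳) :
    |R μ h x y| ≤ (4 * T * C : ℝ≥0) := by
  rw [R_eq_sum hT]
  exact abs_sum_sub_sub_add_le (by omega) (fun _ => abs_E0_le fun _ => hC _)
    (fun _ => abs_E0_le fun _ => hC _) (fun _ => abs_E0_le fun _ => hC _) fun _ => abs_E0_le hC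

lemma abs_S_le (hC : ∀ x, |h x| ≤ C) (x y z : 𝒳) : |S μ h x y z| ≤ (4 * T * C : ℝ≥0) := by
  rw [S_eq_sum]
  exact abs_sum_sub_sub_add_le (by omega) (fun _ => abs_E0_le fun _ => hC _)
    (fun _ => abs_E0_le fun _ => hC _) (fun _ => abs_E0_le fun _ => hC _)
    fun _ => abs_E0_le fun _ => hC _

variable {Ω : Type*} [MeasurableSpace Ω] {A : Measure Ω} [IsFiniteMeasure A]

lemma memLp_condE1_comp {f : Ω → 𝒳} (hf : Measurable f) (hh : Measurable h)
    (hC : ∀ x, |h x| ≤ C) (i : Fin T) : MemLp (fun ω => condE1 μ h i (f ω)) 2 A :=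
  memLp_of_abs_le ((measurable_condE1 hh i).comp hf) fun _ => abs_E0_le fun _ => hC _

lemma memLp_condE2_comp {f : Ω → 𝒳 × 𝒳} (hf : Measurable f) (hh : Measurable h)
    (hC : ∀ x, |h x| ≤ C) (i j : Fin T) : MemLp (fun ω => condE2 μ h i j (f ω).1 (f ω).2) 2 A :=
  memLp_of_abs_le ((measurable_condE2 hh i j).comp hf) fun _ => abs_E0_le fun _ => hC _

lemma memLp_condE3 {A : Measure (𝒳 × 𝒳 × 𝒳)} [IsFiniteMeasure A] (hh : Measurable h)
    (hC : ∀ x, |h x| ≤ C) (i j k : Fin T) :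
    MemLp (fun p : 𝒳 × 𝒳 × 𝒳 => condE3 μ h i j k p.1 p.2.1 p.2.2) 2 A :=
  memLp_of_abs_le (measurable_condE3 hh i j k) fun _ => abs_E0_le fun _ => hC _

end Interaction

section MainTerms

variable {𝒳 : Type*} [MeasurableSpace 𝒳] {T : ℕ} {μ : Measure 𝒳} [IsProbabilityMeasure μ]
  {η₁ η₂ : ℝ} {L : 𝒳 × 𝒳 → ℝ≥0} {V : 𝒳 × 𝒳 × 𝒳 → ℝ≥0} {P : Measure (Fin T → 𝒳)} {i j k : Fin T}
  {h : (Fin T → 𝒳) → ℝ} {C : ℝ≥0}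

namespace IsPerturbedChain

variable (hP : IsPerturbedChain μ η₁ η₂ L V P)
include hP

lemma map_fst_pair (hij : (j : ℕ) = i + 1) :
    ((μ.prod μ).withDensity fun p => (L p : ℝ≥0∞)).map Prod.fst = (μ.prod μ).map Prod.fst := by
  rw [← hP.pairLaw_eq i j hij, map_fst_pairLaw, hP.marginal, measurePreserving_fst.map_eq]

lemma map_snd_pair (hij : (j : ℕ) = i + 1) :
    ((μ.prod μ).withDensity fun p => (L p : ℝ≥0∞)).map Prod.snd = (μ.prod μ).map Prod.snd := by
  rw [← hP.pairLaw_eq i j hij, map_snd_pairLaw, hP.marginal, measurePreserving_snd.map_eq]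

omit [IsProbabilityMeasure μ] in
lemma map_pair_triple (hij : (j : ℕ) = i + 1) (hjk : (k : ℕ) = j + 1) :
    ((markovTriple μ L).withDensity fun p => (V p : ℝ≥0∞)).map (fun p => (p.1, p.2.1)) =
      (markovTriple μ L).map fun p => (p.1, p.2.1) := by
  rw [← hP.tripleLaw_eq i j k hij hjk, map_pair_tripleLaw, hP.pairLaw_eq i j hij,
    hP.map_pair_markovTriple]

omit [IsProbabilityMeasure μ] in
lemma map_snd_triple (hij : (j : ℕ) = i + 1) (hjk : (k : ℕ) = j + 1) :
    ((markovTriple μ L).withDensity fun p => (V p : ℝ≥0∞)).map Prod.snd =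
      (markovTriple μ L).map Prod.snd := by
  rw [← hP.tripleLaw_eq i j k hij hjk, map_snd_tripleLaw, hP.pairLaw_eq j k hjk,
    hP.map_snd_markovTriple]

lemma isProbabilityMeasure_markovTriple (hij : (j : ℕ) = i + 1) (hjk : (k : ℕ) = j + 1) :
    IsProbabilityMeasure (markovTriple μ L) := by
  have := hP.isProbabilityMeasure_halfSpliceLaw hjk
  rw [← hP.tripleLaw_halfSpliceLaw hij hjk]
  exact Measure.isProbabilityMeasure_map (by fun_prop)

lemma integral_mul_condE2 (hij : (j : ℕ) = i + 1) (hh : Measurable h) (hC : ∀ x, |h x| ≤ C) :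
    ∫ p, ((L p : ℝ) - 1) * condE2 μ h i j p.1 p.2 ∂(μ.prod μ) =
      ∫ p, ((L p : ℝ) - 1) * (condE2 μ h i j p.1 p.2 - condE1 μ h i p.1 - condE1 μ h j p.2
        + E0 μ h) ∂(μ.prod μ) := by
  have hL := hP.isChiSqDensity_pair
  have hx : Measurable fun x => -condE1 μ h i x := (measurable_condE1 hh i).neg
  have hy : Measurable fun y => -condE1 μ h j y + E0 μ h :=
    (measurable_condE1 hh j).neg.add_const _
  have hc₂ : MemLp (fun p : 𝒳 × 𝒳 => condE2 μ h i j p.1 p.2) 2 (μ.prod μ) :=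
    memLp_condE2_comp measurable_id hh hC i j
  have hx₂ := (memLp_condE1_comp (A := μ.prod μ) (μ := μ) measurable_fst hh hC i).neg
  have hy₂ := (memLp_condE1_comp (A := μ.prod μ) (μ := μ) measurable_snd hh hC j).neg.add
    (memLp_const (E0 μ h))
  refine (hL.integral_mul_add_comp hc₂ measurable_fst (hP.map_fst_pair hij) hx hx₂).symm.trans
    ((hL.integral_mul_add_comp (hc₂.add hx₂) measurable_snd (hP.map_snd_pair hij) hy
      hy₂).symm.trans ?_)
  simp only [Pi.add_apply, Pi.neg_apply, sub_eq_add_neg, add_assoc]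

lemma integral_mul_condE3 (hij : (j : ℕ) = i + 1) (hjk : (k : ℕ) = j + 1) (hh : Measurable h)
    (hC : ∀ x, |h x| ≤ C) :
    ∫ p, ((V p : ℝ) - 1) * condE3 μ h i j k p.1 p.2.1 p.2.2 ∂(markovTriple μ L) =
      ∫ p, ((V p : ℝ) - 1) * (condE3 μ h i j k p.1 p.2.1 p.2.2 - condE2 μ h i j p.1 p.2.1
        - condE2 μ h j k p.2.1 p.2.2 + condE1 μ h j p.2.1) ∂(markovTriple μ L) := by
  have hV := hP.isChiSqDensity_triple
  have := hP.isProbabilityMeasure_markovTriple hij hjk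
  have hxy : Measurable fun q : 𝒳 × 𝒳 => -condE2 μ h i j q.1 q.2 := (measurable_condE2 hh i j).neg
  have hyz : Measurable fun q : 𝒳 × 𝒳 => -condE2 μ h j k q.1 q.2 + condE1 μ h j q.1 :=
    (measurable_condE2 hh j k).neg.add ((measurable_condE1 hh j).comp measurable_fst)
  have hpair : Measurable fun p : 𝒳 × 𝒳 × 𝒳 => (p.1, p.2.1) := by fun_prop
  have hc₂ := memLp_condE3 (A := markovTriple μ L) (μ := μ) hh hC i j k
  have hxy₂ := (memLp_condE2_comp (A := markovTriple μ L) (μ := μ) hpair hh hC i j).neg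
  have hyz₂ := (memLp_condE2_comp (A := markovTriple μ L) (μ := μ) measurable_snd hh hC j k).neg.add
    (memLp_condE1_comp (μ := μ) measurable_snd.fst hh hC j)
  refine (hV.integral_mul_add_comp hc₂ hpair (hP.map_pair_triple hij hjk) hxy hxy₂).symm.trans
    ((hV.integral_mul_add_comp (hc₂.add hxy₂) measurable_snd (hP.map_snd_triple hij hjk) hyz
      hyz₂).symm.trans ?_)
  simp only [Pi.add_apply, Pi.neg_apply, sub_eq_add_neg, add_assoc]

lemma sum_integral_mul_condE2 (hT : 0 < T) (hh : Measurable h) (hC : ∀ x, |h x| ≤ C) :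
    ∑ t : Fin (T - 1), ∫ p, ((L p : ℝ) - 1) *
        condE2 μ h ⟨t, by omega⟩ ⟨t + 1, by omega⟩ p.1 p.2 ∂(μ.prod μ) =
      ∫ p, ((L p : ℝ) - 1) * R μ h p.1 p.2 ∂(μ.prod μ) := by
  have h_int (i j : Fin T) : Integrable (fun p : 𝒳 × 𝒳 => ((L p : ℝ) - 1) *
      (condE2 μ h i j p.1 p.2 - condE1 μ h i p.1 - condE1 μ h j p.2 + E0 μ h)) (μ.prod μ) :=
    hP.isChiSqDensity_pair.integrable_mul <|
      (((memLp_condE2_comp measurable_id hh hC i j).sub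
        (memLp_condE1_comp measurable_fst hh hC i)).sub
        (memLp_condE1_comp measurable_snd hh hC j)).add (memLp_const _)
  simp only [R_eq_sum hT, Finset.mul_sum]
  rw [integral_finsetSum _ fun t _ => h_int _ _]
  exact Finset.sum_congr rfl fun t _ => hP.integral_mul_condE2 rfl hh hC

lemma sum_integral_mul_condE3 (hT : 2 < T) (hh : Measurable h) (hC : ∀ x, |h x| ≤ C) :
    ∑ t : Fin (T - 2), ∫ p, ((V p : ℝ) - 1) * condE3 μ h ⟨t, by omega⟩ ⟨t + 1, by omega⟩
        ⟨t + 2, by omega⟩ p.1 p.2.1 p.2.2 ∂(markovTriple μ L) =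
      ∫ p, ((V p : ℝ) - 1) * S μ h p.1 p.2.1 p.2.2 ∂(markovTriple μ L) := by
  have := hP.isProbabilityMeasure_markovTriple
    (i := ⟨0, by omega⟩) (j := ⟨1, by omega⟩) (k := ⟨2, hT⟩) rfl rfl
  have hpair : Measurable fun p : 𝒳 × 𝒳 × 𝒳 => (p.1, p.2.1) := by fun_prop
  have h_int (i j k : Fin T) : Integrable (fun p : 𝒳 × 𝒳 × 𝒳 => ((V p : ℝ) - 1) *
      (condE3 μ h i j k p.1 p.2.1 p.2.2 - condE2 μ h i j p.1 p.2.1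
        - condE2 μ h j k p.2.1 p.2.2 + condE1 μ h j p.2.1)) (markovTriple μ L) :=
    hP.isChiSqDensity_triple.integrable_mul <|
      (((memLp_condE3 hh hC i j k).sub (memLp_condE2_comp hpair hh hC i j)).sub
        (memLp_condE2_comp measurable_snd hh hC j k)).add
        (memLp_condE1_comp measurable_snd.fst hh hC j)
  simp only [S_eq_sum, Finset.mul_sum]
  rw [integral_finsetSum _ fun t _ => h_int _ _ _]
  exact Finset.sum_congr rfl fun t _ => hP.integral_mul_condE3 rfl rfl hh hC

lemma abs_integral_mul_R_le (hT : 1 < T) (hη₁ : 0 ≤ η₁) (hh : Measurable h)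
    (hC : ∀ x, |h x| ≤ C) :
    |∫ p, ((L p : ℝ) - 1) * R μ h p.1 p.2 ∂(μ.prod μ)| ≤ √(varR μ h * η₁) := by
  have := hP.isProbabilityMeasure
  have hprob : IsProbabilityMeasure ((μ.prod μ).withDensity fun p => (L p : ℝ≥0∞)) := by
    rw [← hP.pairLaw_eq ⟨0, by omega⟩ ⟨1, by omega⟩ rfl]
    exact Measure.isProbabilityMeasure_map (by fun_prop)
  rw [varR, mul_comm, Real.sqrt_mul hη₁]
  exact hP.isChiSqDensity_pair.abs_integral_mul_le_sqrt_variance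
    (memLp_of_abs_le (measurable_R hh) fun p => abs_R_le (by omega) hC p.1 p.2)

lemma abs_integral_mul_S_le (hT : 2 < T) (hη₂ : 0 ≤ η₂) (hh : Measurable h)
    (hC : ∀ x, |h x| ≤ C) :
    |∫ p, ((V p : ℝ) - 1) * S μ h p.1 p.2.1 p.2.2 ∂(markovTriple μ L)| ≤
      √(varS μ h * η₂) + 8 * T * C * √(T * (√η₁ + √η₂)) * √η₂ := by
  let i : Fin T := ⟨0, by omega⟩
  let j : Fin T := ⟨1, by omega⟩
  let k : Fin T := ⟨2, hT⟩
  have := hP.isProbabilityMeasure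
  have := hP.isProbabilityMeasure_markovTriple (i := i) (j := j) (k := k) rfl rfl
  have hprob : IsProbabilityMeasure ((markovTriple μ L).withDensity fun p => (V p : ℝ≥0∞)) := by
    rw [← hP.tripleLaw_eq i j k rfl rfl]
    exact Measure.isProbabilityMeasure_map (by fun_prop)
  have hclose : TVClose (markovTriple μ L) (μ.prod (μ.prod μ)) (T * (√η₁ + √η₂)) := by
    have h := (hP.tvClose_halfSpliceLaw_baseline (j := j) (k := k) rfl).map
      (π := fun x => (x i, x j, x k)) (by fun_prop)
    have h₁ := hP.tripleLaw_halfSpliceLaw (i := i) (j := j) (k := k) rfl rfl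
    have h₀ := tripleLaw_baseline (T := T) μ (i := i) (j := j) (k := k) (by simp [i, j])
      (by simp [i, k]) (by simp [j, k])
    rw [tripleLaw] at h₁ h₀
    rwa [h₁, h₀] at h
  have hS (p : 𝒳 × 𝒳 × 𝒳) : |S μ h p.1 p.2.1 p.2.2| ≤ (4 * T * C : ℝ≥0) := abs_S_le hC _ _ _
  calc |∫ p, ((V p : ℝ) - 1) * S μ h p.1 p.2.1 p.2.2 ∂(markovTriple μ L)|
      ≤ √η₂ * √(variance (fun p : 𝒳 × 𝒳 × 𝒳 => S μ h p.1 p.2.1 p.2.2) (markovTriple μ L)) :=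
        hP.isChiSqDensity_triple.abs_integral_mul_le_sqrt_variance
          (memLp_of_abs_le (measurable_S hh) hS)
    _ ≤ √η₂ * (√(varS μ h) + 2 * (4 * T * C : ℝ≥0) * √(T * (√η₁ + √η₂))) :=
        mul_le_mul_of_nonneg_left (hclose.sqrt_variance_le (measurable_S hh) hS)
          (Real.sqrt_nonneg _)
    _ = √(varS μ h * η₂) + 8 * T * C * √(T * (√η₁ + √η₂)) * √η₂ := by
        rw [mul_comm (varS μ h), Real.sqrt_mul hη₂]
        push_cast
        ring

end IsPerturbedChain

end MainTerms

section Expansion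

lemma abs_sum_sub_le {n N : ℕ} (hn : n ≤ N) {a b : Fin n → ℝ} {ε : ℝ} (hε : 0 ≤ ε)
    (hab : ∀ t, |a t - b t| ≤ ε) : |∑ t, a t - ∑ t, b t| ≤ N * ε := by
  rw [← Finset.sum_sub_distrib]
  calc |∑ t, (a t - b t)| ≤ ∑ t, |a t - b t| := Finset.abs_sum_le_sum_abs _ _
    _ ≤ ∑ _ : Fin n, ε := Finset.sum_le_sum fun t _ => hab t
    _ = n * ε := by rw [Finset.sum_const, Finset.card_univ, Fintype.card_fin, nsmul_eq_mul]
    _ ≤ N * ε := by gcongr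

lemma sub_eq_sum_sub_add_sum_sub {T : ℕ} (hT : 2 ≤ T) (b : ℕ → ℝ) (b' : Fin (T - 1) → ℝ)
    (h₀ : b' ⟨0, by omega⟩ = b 2) :
    b T - b 1 = ∑ t : Fin (T - 1), (b' t - b (t + 1)) +
      ∑ t : Fin (T - 2), (b (t + 3) - b' ⟨t + 1, by omega⟩) := by
  obtain ⟨m, rfl⟩ := Nat.exists_eq_add_of_le' hT
  have telescope : ∑ t : Fin m, (b (t + 3) - b (t + 2)) = b (m + 2) - b 2 := by
    rw [Fin.sum_univ_eq_sum_range fun t => b (t + 3) - b (t + 2)]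
    exact Finset.sum_range_sub (fun t => b (t + 2)) m
  change b' (0 : Fin (m + 1)) = b 2 at h₀
  change _ = ∑ t : Fin (m + 1), (b' t - b (t + 1)) +
    ∑ t : Fin m, (b (t + 3) - b' t.succ)
  rw [Fin.sum_univ_succ, add_assoc, ← Finset.sum_add_distrib]
  simp only [Fin.val_succ, Fin.val_zero, add_assoc, Nat.reduceAdd, sub_add_sub_cancel']
  rw [telescope, h₀, sub_add_sub_cancel']

variable {𝒳 : Type*} [MeasurableSpace 𝒳] {T : ℕ} {μ : Measure 𝒳} [IsProbabilityMeasure μ]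
  {η₁ η₂ : ℝ} {L : 𝒳 × 𝒳 → ℝ≥0} {V : 𝒳 × 𝒳 × 𝒳 → ℝ≥0} {P : Measure (Fin T → 𝒳)} {i j k : Fin T}
  {h : (Fin T → 𝒳) → ℝ} {C : ℝ≥0}

namespace IsPerturbedChain

variable (hP : IsPerturbedChain μ η₁ η₂ L V P)
include hP

lemma abs_integral_halfSpliceLaw_sub_sub_le (hjk : (k : ℕ) = j + 1) (hh : Measurable h)
    (hC : ∀ x, |h x| ≤ C) :
    |(∫ x, h x ∂(halfSpliceLaw μ P L j k)) - (∫ x, h x ∂(spliceLaw μ P k)) -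
      ∫ p, ((L p : ℝ) - 1) * condE2 μ h j k p.1 p.2 ∂(μ.prod μ)| ≤
      √η₁ * (2 * C * √(T * (√η₁ + √η₂))) := by
  have := hP.isProbabilityMeasure
  have hexp := (hP.isChiSqDensity_map_spliceLaw hjk).abs_integral_withDensity_sub_sub_le
    (by fun_prop) (hP.tvClose_spliceLaw_baseline hjk) hh (measurable_condE2 hh j k) hC
    (fun _ => abs_E0_le fun _ => hC _)
    (condExp_baseline_ae_eq_condE2 μ (Fin.ne_of_val_ne (by omega)) hh
      (memLp_one_iff_integrable.1 (memLp_of_abs_le hh hC)))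
  rwa [map_pair_spliceLaw (by omega) rfl (hP.marginal j)] at hexp

lemma abs_integral_spliceLaw_add_one_sub_sub_le (hij : (j : ℕ) = i + 1) (hjk : (k : ℕ) = j + 1)
    (hh : Measurable h) (hC : ∀ x, |h x| ≤ C) :
    |(∫ x, h x ∂(spliceLaw μ P (k + 1))) - (∫ x, h x ∂(halfSpliceLaw μ P L j k)) -
      ∫ p, ((V p : ℝ) - 1) * condE3 μ h i j k p.1 p.2.1 p.2.2 ∂(markovTriple μ L)| ≤
      √η₂ * (2 * C * √(T * (√η₁ + √η₂))) := by
  have := hP.isProbabilityMeasure_halfSpliceLaw hjk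
  rw [hP.spliceLaw_add_one hij hjk, ← hP.tripleLaw_halfSpliceLaw hij hjk]
  exact (hP.isChiSqDensity_tripleLaw_halfSpliceLaw hij hjk).abs_integral_withDensity_sub_sub_le
    (by fun_prop) (hP.tvClose_halfSpliceLaw_baseline hjk) hh (measurable_condE3 hh i j k) hC
    (fun _ => abs_E0_le fun _ => hC _)
    (condExp_baseline_ae_eq_condE3 μ (Fin.ne_of_val_ne (by omega)) (Fin.ne_of_val_ne (by omega))
      (Fin.ne_of_val_ne (by omega)) hh (memLp_one_iff_integrable.1 (memLp_of_abs_le hh hC)))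

lemma abs_sum_integral_halfSpliceLaw_sub_le (hT : 0 < T) (hh : Measurable h)
    (hC : ∀ x, |h x| ≤ C) :
    |∑ t : Fin (T - 1), ((∫ x, h x ∂(halfSpliceLaw μ P L ⟨t, by omega⟩ ⟨t + 1, by omega⟩)) -
        ∫ x, h x ∂(spliceLaw μ P (t + 1))) -
      ∫ p, ((L p : ℝ) - 1) * R μ h p.1 p.2 ∂(μ.prod μ)| ≤
      T * (√η₁ * (2 * C * √(T * (√η₁ + √η₂)))) := by
  rw [← hP.sum_integral_mul_condE2 hT hh hC]
  exact abs_sum_sub_le (by omega) (by positivity) fun t =>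
    hP.abs_integral_halfSpliceLaw_sub_sub_le rfl hh hC

lemma abs_sum_integral_spliceLaw_sub_le (hT : 2 < T) (hh : Measurable h)
    (hC : ∀ x, |h x| ≤ C) :
    |∑ t : Fin (T - 2), ((∫ x, h x ∂(spliceLaw μ P (t + 3))) -
        ∫ x, h x ∂(halfSpliceLaw μ P L ⟨t + 1, by omega⟩ ⟨t + 2, by omega⟩)) -
      ∫ p, ((V p : ℝ) - 1) * S μ h p.1 p.2.1 p.2.2 ∂(markovTriple μ L)| ≤
      T * (√η₂ * (2 * C * √(T * (√η₁ + √η₂)))) := by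
  rw [← hP.sum_integral_mul_condE3 hT hh hC]
  exact abs_sum_sub_le (by omega) (by positivity) fun t =>
    hP.abs_integral_spliceLaw_add_one_sub_sub_le (i := ⟨t, by omega⟩) (j := ⟨t + 1, by omega⟩)
      (k := ⟨t + 2, by omega⟩) rfl rfl hh hC

lemma integral_sub_E0_eq_sum (hT : 2 ≤ T) :
    ∫ x, h x ∂P - E0 μ h =
      ∑ t : Fin (T - 1), ((∫ x, h x ∂(halfSpliceLaw μ P L ⟨t, by omega⟩ ⟨t + 1, by omega⟩)) -
        ∫ x, h x ∂(spliceLaw μ P (t + 1))) +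
      ∑ t : Fin (T - 2), ((∫ x, h x ∂(spliceLaw μ P (t + 3))) -
        ∫ x, h x ∂(halfSpliceLaw μ P L ⟨t + 1, by omega⟩ ⟨t + 2, by omega⟩)) := by
  have := hP.isProbabilityMeasure
  have hsum := sub_eq_sum_sub_add_sum_sub hT (fun n => ∫ x, h x ∂(spliceLaw μ P n))
    (fun t => ∫ x, h x ∂(halfSpliceLaw μ P L ⟨t, by omega⟩ ⟨t + 1, by omega⟩))
    (by rw [hP.spliceLaw_two (i := ⟨0, by omega⟩) (j := ⟨1, by omega⟩) rfl rfl])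
  simp only [spliceLaw_of_le le_rfl,
    spliceLaw_one (i := ⟨0, by omega⟩) rfl (hP.marginal _)] at hsum
  exact hsum

theorem abs_integral_sub_E0_le (hT : 2 < T) (hη₁ : 0 ≤ η₁) (hη₂ : 0 ≤ η₂) (hh : Measurable h)
    (hC : ∀ x, |h x| ≤ C) :
    |∫ x, h x ∂P - E0 μ h| ≤ √(varR μ h * η₁) + √(varS μ h * η₂) +
      10 * (T * C) * √(T * (√η₁ + √η₂)) * (√η₁ + √η₂) := by
  have hR := hP.abs_integral_mul_R_le (by omega) hη₁ hh hC
  have hS := hP.abs_integral_mul_S_le hT hη₂ hh hC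
  have hpairs := hP.abs_sum_integral_halfSpliceLaw_sub_le (by omega) hh hC
  have htriples := hP.abs_sum_integral_spliceLaw_sub_le hT hh hC
  rw [hP.integral_sub_E0_eq_sum hT.le]
  have hnonneg : 0 ≤ T * C * √(T * (√η₁ + √η₂)) * √η₁ := by positivity
  rw [abs_le] at *
  constructor <;> linarith

end IsPerturbedChain

end Expansion

section BaselineFeasible

lemma chiSq_self {E : Type*} [MeasurableSpace E] (ν : Measure E) [SigmaFinite ν] :
    chiSq ν ν = 0 := by
  rw [chiSq, if_pos Measure.AbsolutelyContinuous.rfl, ← lintegral_zero (μ := ν)]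
  refine lintegral_congr_ae ?_
  filter_upwards [ν.rnDeriv_self] with e he
  simp [he]

variable {𝒳 : Type*} [MeasurableSpace 𝒳] (μ : Measure 𝒳) [IsProbabilityMeasure μ] (T : ℕ)

lemma iIndepFun_eval_baseline :
    iIndepFun (fun (i : Fin T) (x : Fin T → 𝒳) => x i) (baseline μ T) :=
  iIndepFun_pi (μ := fun _ : Fin T => μ) (X := fun _ x => x) fun _ => aemeasurable_id

lemma indep_cylinderEvents_baseline {Δ Δ' : Set (Fin T)} (hΔ : Disjoint Δ Δ') :
    Indep (cylinderEvents (X := fun _ : Fin T => 𝒳) Δ)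
      (cylinderEvents (X := fun _ : Fin T => 𝒳) Δ') (baseline μ T) :=
  indep_iSup_of_disjoint (fun i => (measurable_pi_apply i).comap_le)
    (iIndepFun_eval_baseline μ T) hΔ

lemma condExp_cylinderEvents_baseline {Δ Δ' : Set (Fin T)} (hΔ : Disjoint Δ Δ')
    {A : Set (Fin T → 𝒳)} (hA : MeasurableSet[cylinderEvents (X := fun _ : Fin T => 𝒳) Δ] A) :
    (baseline μ T)[A.indicator (fun _ => (1 : ℝ)) | cylinderEvents (X := fun _ : Fin T => 𝒳) Δ']
      =ᵐ[baseline μ T] fun _ => (baseline μ T).real A := by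
  have h := condExp_indep_eq (f := A.indicator fun _ => (1 : ℝ)) cylinderEvents_le_pi
    cylinderEvents_le_pi (measurable_const.indicator hA).stronglyMeasurable
    (indep_cylinderEvents_baseline μ T hΔ)
  simpa only [integral_indicator_const _ (cylinderEvents_le_pi _ hA), smul_eq_mul, mul_one] using h

lemma isDependent_baseline (p : ℕ) : IsDependent p (baseline μ T) := by
  intro t A B hA hB
  set past := {s : Fin T | (s : ℕ) < t}
  set present := {s : Fin T | t ≤ (s : ℕ) ∧ (s : ℕ) < t + p}
  set future := {s : Fin T | t + p ≤ (s : ℕ)}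
  have past_present : Disjoint past present := Set.disjoint_left.2 fun s hs hs' =>
    (not_le_of_gt hs) hs'.1
  have future_present : Disjoint future present := Set.disjoint_left.2 fun s hs hs' =>
    (not_le_of_gt hs'.2) hs
  have past_future : Disjoint past future := Set.disjoint_left.2 fun s hs hs' =>
    (not_le_of_gt hs) ((Nat.le_add_right t p).trans hs')
  have hAB : MeasurableSet[cylinderEvents (X := fun _ : Fin T => 𝒳) (past ∪ future)] (A ∩ B) :=
    (cylinderEvents_mono Set.subset_union_left _ hA).inter
      (cylinderEvents_mono Set.subset_union_right _ hB)
  filter_upwards [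
    condExp_cylinderEvents_baseline μ T (past_present.union_left future_present) hAB,
    condExp_cylinderEvents_baseline μ T past_present hA,
    condExp_cylinderEvents_baseline μ T future_present hB] with x hx_inter hx_past hx_future
  rw [hx_inter, Pi.mul_apply, hx_past, hx_future, Measure.real, Measure.real, Measure.real,
    (Indep_iff _ _ _).1 (indep_cylinderEvents_baseline μ T past_future) A B hA hB,
    ENNReal.toReal_mul]

lemma map_comp_baseline {m : ℕ} {g : Fin m → Fin T} (hg : Function.Injective g) :
    (baseline μ T).map (fun x i => x (g i)) = baseline μ m := by
  have h := (iIndepFun_iff_map_fun_eq_pi_map fun i => (measurable_pi_apply (g i)).aemeasurable).1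
    ((iIndepFun_eval_baseline μ T).precomp hg)
  simp only [map_eval_baseline] at h
  exact h

lemma isStationary_baseline : IsStationary (baseline μ T) := fun m s hs =>
  (map_comp_baseline μ T (g := fun i : Fin m => ⟨s + i, by omega⟩) fun i j hij =>
    Fin.ext (Nat.add_left_cancel (Fin.mk.inj hij))).trans
    (map_comp_baseline μ T (g := fun i : Fin m => ⟨i, by omega⟩) fun _ _ hij =>
      Fin.ext (Fin.mk.inj hij)).symm

lemma isFeasible_baseline (η₁ η₂ : ℝ) : IsFeasible μ η₁ η₂ (baseline μ T) where
  isProbabilityMeasure := inferInstance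
  lagOne i j hij := by
    rw [pairLaw_baseline μ (Fin.ne_of_val_ne (by omega)), phiSq, measurePreserving_fst.map_eq,
      measurePreserving_snd.map_eq, chiSq_self]
    exact zero_le
  lagTwo := by
    refine ⟨baseline μ T, ⟨inferInstance, isDependent_baseline μ T 1, fun _ _ _ => rfl⟩,
      fun i j k hij hjk => ?_⟩
    rw [tripleLaw_baseline μ (Fin.ne_of_val_ne (by omega)) (Fin.ne_of_val_ne (by omega))
      (Fin.ne_of_val_ne (by omega)), chiSq_self]
    exact zero_le
  isDependent := isDependent_baseline μ T 2
  isStationary := isStationary_baseline μ T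
  marginal := map_eval_baseline μ
  absolutelyContinuous := Measure.AbsolutelyContinuous.rfl

end BaselineFeasible

section Values

variable {𝒳 : Type*} [MeasurableSpace 𝒳] {μ : Measure 𝒳} [IsProbabilityMeasure μ] {T : ℕ}
  {h : (Fin T → 𝒳) → ℝ} {η₁ η₂ v : ℝ}

lemma nonempty_values : (values μ h η₁ η₂).Nonempty :=
  ⟨_, baseline μ T, isFeasible_baseline μ T η₁ η₂, rfl⟩

omit [IsProbabilityMeasure μ] in
lemma abs_le_of_mem_values {C : ℝ} (hC : ∀ x, |h x| ≤ C) (hv : v ∈ values μ h η₁ η₂) :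
    |v| ≤ C := by
  obtain ⟨P, hP, rfl⟩ := hv
  have := hP.isProbabilityMeasure
  simpa using norm_integral_le_of_norm_le_const (μ := P) (f := h) (ae_of_all _ hC)

lemma abs_sub_E0_le_of_mem_values (hT : 2 < T) (hη₁ : 0 ≤ η₁) (hη₂ : 0 ≤ η₂) (hh : Measurable h)
    {C : ℝ≥0} (hC : ∀ x, |h x| ≤ C) (hv : v ∈ values μ h η₁ η₂) :
    |v - E0 μ h| ≤ √(varR μ h * η₁) + √(varS μ h * η₂) +
      10 * (T * C) * √(T * (√η₁ + √η₂)) * (√η₁ + √η₂) := by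
  obtain ⟨P, hP, rfl⟩ := hv
  obtain ⟨L, V, hLV⟩ := hP.exists_isPerturbedChain hT hη₁ hη₂
  exact hLV.abs_integral_sub_E0_le hT hη₁ hη₂ hh hC

end Values

lemma isLittleO_mul_sqrt_mul (M N : ℝ) :
    (fun η : ℝ × ℝ => M * √(N * (√η.1 + √η.2)) * (√η.1 + √η.2))
      =o[𝓝 0] fun η => √η.1 + √η.2 := by
  have hcont : Continuous fun η : ℝ × ℝ => M * √(N * (√η.1 + √η.2)) := by fun_prop
  have hlim := hcont.tendsto 0
  simp only [Prod.fst_zero, Prod.snd_zero, Real.sqrt_zero, add_zero, mul_zero] at hlim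
  simpa only [one_mul] using ((Asymptotics.isLittleO_one_iff ℝ).2 hlim).mul_isBigO
    (Asymptotics.isBigO_refl (fun η : ℝ × ℝ => √η.1 + √η.2) _)

end SerialDependency

theorem theorem4 {𝒳 : Type*} [MeasurableSpace 𝒳] (μ : Measure 𝒳) [IsProbabilityMeasure μ]
    (T : ℕ) (hT : 2 < T) (h : (Fin T → 𝒳) → ℝ) (h_meas : Measurable h)
    (h_bdd : ∃ C : ℝ, ∀ x, |h x| ≤ C) :
    (∀ η₁ η₂ : ℝ, 0 ≤ η₁ → 0 ≤ η₂ →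
      (SerialDependency.values μ h η₁ η₂).Nonempty ∧
      BddAbove (SerialDependency.values μ h η₁ η₂) ∧
      BddBelow (SerialDependency.values μ h η₁ η₂)) ∧
    (∃ r : ℝ × ℝ → ℝ,
      Asymptotics.IsLittleO (𝓝[Set.Ici 0 ×ˢ Set.Ici 0] ((0, 0) : ℝ × ℝ)) r
        (fun η => √η.1 + √η.2) ∧
      ∀ η₁ η₂ : ℝ, 0 ≤ η₁ → 0 ≤ η₂ →
        SerialDependency.maxValue μ h η₁ η₂ ≤
          SerialDependency.E0 μ h + √(SerialDependency.varR μ h * η₁)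
            + √(SerialDependency.varS μ h * η₂) + r (η₁, η₂)) ∧
    (∃ r : ℝ × ℝ → ℝ,
      Asymptotics.IsLittleO (𝓝[Set.Ici 0 ×ˢ Set.Ici 0] ((0, 0) : ℝ × ℝ)) r
        (fun η => √η.1 + √η.2) ∧
      ∀ η₁ η₂ : ℝ, 0 ≤ η₁ → 0 ≤ η₂ →
        SerialDependency.minValue μ h η₁ η₂ ≥
          SerialDependency.E0 μ h - √(SerialDependency.varR μ h * η₁)
            - √(SerialDependency.varS μ h * η₂) + r (η₁, η₂)) := by
  open SerialDependency in
  obtain ⟨C, hC⟩ := h_bdd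
  have bound {η₁ η₂ : ℝ} (hη₁ : 0 ≤ η₁) (hη₂ : 0 ≤ η₂) {v : ℝ} (hv : v ∈ values μ h η₁ η₂) :=
    abs_le.1 <| abs_sub_E0_le_of_mem_values hT hη₁ hη₂ h_meas
      (fun x => (hC x).trans (Real.le_coe_toNNReal C)) hv
  have remainder := (isLittleO_mul_sqrt_mul (10 * (T * C.toNNReal)) T).mono
    (nhdsWithin_le_nhds (s := Set.Ici 0 ×ˢ Set.Ici 0))
  refine ⟨fun η₁ η₂ _ _ => ⟨nonempty_values,
      ⟨C, fun v hv => (abs_le.1 (abs_le_of_mem_values hC hv)).2⟩,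
      ⟨-C, fun v hv => (abs_le.1 (abs_le_of_mem_values hC hv)).1⟩⟩,
    ⟨_, remainder, fun η₁ η₂ hη₁ hη₂ => csSup_le nonempty_values fun v hv => ?_⟩,
    ⟨_, remainder.neg_left, fun η₁ η₂ hη₁ hη₂ => le_csInf nonempty_values fun v hv => ?_⟩⟩
  · linarith [(bound hη₁ hη₂ hv).2]
  · linarith [(bound hη₁ hη₂ hv).1]
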